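/- Let $(W,S)$ be a finite Coxeter system, $S=\{s_1,\dots,s_n\}$, acting on a Euclidean space $V$ with a (finite, reduced, not necessarily crystallographic) root system $\Phi$ associated with it, whose simple roots $\alpha_s$ $(s\in S)$ form a basis of $V$; thus $s$ acts as the orthogonal reflection along $\alpha_s$. The list of inversions of a word $P=(p_1,\dots,p_r)$ in $S$ is $\operatorname{inv}(P)=(\gamma_1,\dots,\gamma_r)$ with $\gamma_i=p_1\cdots p_{i-1}(\alpha_{p_i})$. Let $c=c_1\cdots c_n$ be a Coxeter element, given by a word in which every element of $S$ occurs exactly once. Let $w_\circ(c)$ be the lexicographically first subword (with respect to sequences of positions) of $c^\infty=c\,c\,c\cdots$ that is a reduced expression of the longest element $w_\circ$ of $W$. Let $J\subseteq S$, let $W_J$ be the standard parabolic subgroup generated by $J$, and let $\Phi'=\Phi\cap\operatorname{span}\{\alpha_s : s\in J\}$ be its root subsystem. Let $c'$ be the restriction of $c$ to $W_J$, that is, the word obtained from $c$ by deleting the letters not in $J$, and let $w_\circ(c')$ be the lexicographically first subword of $c'^\infty$ that is a reduced expression, in the generators $J$, of the longest element of $W_J$ (the empty word if $J=\emptyset$).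 Then the sublist of $\operatorname{inv}(w_\circ(c))$ consisting of the roots that belong to $\Phi'$, in the same order, is equal to $\operatorname{inv}(u)$ for a word $u$ in the letters of $J$ that is equal to $w_\circ(c')$ up to commutations of consecutive commuting letters. -/

import Mathlib

open scoped InnerProductSpace

namespace CoxeterSystem

variable {B W : Type*} [Group W] {M : CoxeterMatrix B}

/-! ### Root systems of a Coxeter system -/

/-- A (finite, reduced, not necessarily crystallographic) root system in a Euclidean space `V`
associated with the Coxeter system `(W, S)`: the group `W` acts faithfully on `V`, each simple
generator `sᵢ` acts as the orthogonal reflection along the simple root `αᵢ`, and the simple roots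
form a basis of `V` which is a simple system of the root system. The positive roots are the roots
with nonnegative coordinates in the simple roots. -/
structure EuclideanRootSystem (cs : CoxeterSystem M W) (V : Type*) [NormedAddCommGroup V]
    [InnerProductSpace ℝ V] where
  /-- the action of `W` on `V` -/
  act : Representation ℝ W V
  act_injective : Function.Injective act
  /-- the set `Φ` of roots -/
  roots : Set V
  finite_roots : roots.Finite
  zero_notMem : (0 : V) ∉ roots
  /-- `Φ` is stable under the reflection along each of its elements -/
  reflection_mem : ∀ β ∈ roots, ∀ γ ∈ roots, γ - (2 * ⟪β, γ⟫_ℝ / ⟪β, β⟫_ℝ) • β ∈ roots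
  /-- the only multiples of a root `β` that are roots are `β` and `-β` -/
  eq_or_eq_neg : ∀ β ∈ roots, ∀ t : ℝ, t • β ∈ roots → t = 1 ∨ t = -1
  /-- the simple roots `αᵢ` -/
  simpleRoot : Module.Basis B ℝ V
  simpleRoot_mem : ∀ i, simpleRoot i ∈ roots
  /-- each root is a nonnegative or a nonpositive combination of simple roots -/
  nonneg_or_nonpos : ∀ β ∈ roots,
    (∀ i, 0 ≤ simpleRoot.repr β i) ∨ (∀ i, simpleRoot.repr β i ≤ 0)
  act_simple : ∀ (i : B) (v : V), act (cs.simple i) v =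
    v - (2 * ⟪simpleRoot i, v⟫_ℝ / ⟪simpleRoot i, simpleRoot i⟫_ℝ) • simpleRoot i

/-- The list of inversions `γ₁, …, γᵣ` of a word `p₁ ⋯ pᵣ`, where `γₖ = p₁ ⋯ pₖ₋₁ (α_{pₖ})`. -/
noncomputable def EuclideanRootSystem.inv {cs : CoxeterSystem M W} {V : Type*}
    [NormedAddCommGroup V] [InnerProductSpace ℝ V] (R : cs.EuclideanRootSystem V)
    (ω : List B) : List V :=
  List.ofFn fun k : Fin ω.length =>
    R.act (cs.wordProd (ω.take k)) (R.simpleRoot (ω.get k))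

/-- The root subsystem `Φ'` of the standard parabolic subgroup generated by `J`: the roots in the
span of the simple roots indexed by `J`. -/
def EuclideanRootSystem.parabolicRoots {cs : CoxeterSystem M W} {V : Type*}
    [NormedAddCommGroup V] [InnerProductSpace ℝ V] (R : cs.EuclideanRootSystem V)
    (J : Set B) : Set V :=
  R.roots ∩ (Submodule.span ℝ (R.simpleRoot '' J) : Set V)

/-! ### Standard parabolic subgroups

The generating set is `{sᵢ | i ∈ J}`; the whole group is the case `J = Set.univ`. -/

/-- The standard parabolic subgroup `W_J`. -/
def parabolic (cs : CoxeterSystem M W) (J : Set B) : Subgroup W :=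
  Subgroup.closure (cs.simple '' J)

/-- The length of an element of `W_J` with respect to the generators indexed by `J`. -/
noncomputable def parabolicLength (cs : CoxeterSystem M W) (J : Set B) (w : W) : ℕ :=
  sInf {n | ∃ ω : List B, (∀ i ∈ ω, i ∈ J) ∧ cs.wordProd ω = w ∧ ω.length = n}

/-- `ω` is a reduced expression of `w` in the generators indexed by `J`. -/
def IsReducedExpr (cs : CoxeterSystem M W) (J : Set B) (w : W) (ω : List B) : Prop :=
  (∀ i ∈ ω, i ∈ J) ∧ cs.wordProd ω = w ∧ ω.length = cs.parabolicLength J w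

/-- `w` is the longest element of `W_J`. -/
def IsLongest (cs : CoxeterSystem M W) (J : Set B) (w : W) : Prop :=
  w ∈ cs.parabolic J ∧ ∀ u ∈ cs.parabolic J, cs.parabolicLength J u ≤ cs.parabolicLength J w

/-! ### Coxeter elements and sorting words -/

/-- `c` is a word of a Coxeter element of `W_J`: each `i ∈ J` occurs exactly once, and no other
letter occurs. -/
def IsCoxeterWord (J : Set B) (c : List B) : Prop :=
  c.Nodup ∧ ∀ i, i ∈ c ↔ i ∈ J

/-- `ω` is the subword of the infinite word `c^∞ = c c c ⋯` at the positions `p₁ < p₂ < ⋯`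
(counted from `0`). -/
def IsSubwordAt (c : List B) (p : List ℕ) (ω : List B) : Prop :=
  p.Pairwise (· < ·) ∧ p.map (fun k => (c)[k % c.length]?) = ω.map some

/-- `ω` is the `c`-sorting word of `w ∈ W_J`, for a word `c` of a Coxeter element of `W_J`: the
subword of `c^∞` at the lexicographically first sequence of positions at which a reduced
expression of `w` stands. -/
def IsSortingWord (cs : CoxeterSystem M W) (J : Set B) (c : List B) (w : W) (ω : List B) : Prop :=
  cs.IsReducedExpr J w ω ∧ ∃ p, IsSubwordAt c p ω ∧
    ∀ q ω', IsSubwordAt c q ω' → cs.IsReducedExpr J w ω' → p = q ∨ List.Lex (· < ·) p q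

theorem parabolicLength_univ (cs : CoxeterSystem M W) (w : W) :
    cs.parabolicLength Set.univ w = cs.length w := by
  apply le_antisymm
  · obtain ⟨ω, hω, rfl⟩ := cs.exists_isReduced w
    exact Nat.sInf_le ⟨ω, by simp, rfl, hω.symm⟩
  · have hne : {n | ∃ ω : List B, (∀ i ∈ ω, i ∈ (Set.univ : Set B)) ∧
        cs.wordProd ω = w ∧ ω.length = n}.Nonempty := by
      obtain ⟨ω, hω, rfl⟩ := cs.exists_isReduced w
      exact ⟨_, ω, by simp, rfl, rfl⟩
    obtain ⟨ω, -, h2, h3⟩ := Nat.sInf_mem hne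
    unfold parabolicLength
    rw [← h3, ← h2]
    exact cs.length_wordProd_le ω

theorem exists_isReducedExpr (cs : CoxeterSystem M W) {J : Set B} {w : W}
    (hw : w ∈ cs.parabolic J) : ∃ ω, cs.IsReducedExpr J w ω := by
  have hex : ∃ ω : List B, (∀ i ∈ ω, i ∈ J) ∧ cs.wordProd ω = w := by
    unfold parabolic at hw
    induction hw using Subgroup.closure_induction with
    | mem x hx =>
      obtain ⟨i, hi, rfl⟩ := hx
      exact ⟨[i], by simpa using hi, by simp⟩
    | one => exact ⟨[], by simp, by simp⟩
    | mul x y _ _ hx hy =>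
      obtain ⟨a, ha, rfl⟩ := hx
      obtain ⟨b, hb, rfl⟩ := hy
      refine ⟨a ++ b, ?_, cs.wordProd_append a b⟩
      intro i hi
      rcases List.mem_append.1 hi with h | h
      exacts [ha i h, hb i h]
    | inv x _ hx =>
      obtain ⟨a, ha, rfl⟩ := hx
      exact ⟨a.reverse, by simpa using ha, cs.wordProd_reverse a⟩
  obtain ⟨ω, h1, h2⟩ := hex
  have hne : {n | ∃ ω : List B, (∀ i ∈ ω, i ∈ J) ∧ cs.wordProd ω = w ∧ ω.length = n}.Nonempty :=
    ⟨_, ω, h1, h2, rfl⟩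
  obtain ⟨ω', a, b, d⟩ := Nat.sInf_mem hne
  exact ⟨ω', a, b, d⟩

theorem exists_isSubwordAt {J : Set B} {c : List B} (hc : IsCoxeterWord J c) (ω : List B)
    (hω : ∀ i ∈ ω, i ∈ J) : ∃ p, IsSubwordAt c p ω := by
  suffices h : ∀ m : ℕ, ∃ p, IsSubwordAt c p ω ∧ ∀ k ∈ p, m * c.length ≤ k by
    obtain ⟨p, hp, -⟩ := h 0
    exact ⟨p, hp⟩
  induction ω with
  | nil => exact fun m => ⟨[], by simp [IsSubwordAt], by simp⟩
  | cons a t ih =>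
    intro m
    obtain ⟨p, ⟨hp1, hp2⟩, hp3⟩ := ih (fun i hi => hω i (List.mem_cons_of_mem _ hi)) (m + 1)
    obtain ⟨j, hj, hja⟩ := List.getElem_of_mem ((hc.2 a).2 (hω a (by simp)))
    refine ⟨(m * c.length + j) :: p, ⟨List.pairwise_cons.2 ⟨?_, hp1⟩, ?_⟩, ?_⟩
    · intro k hk
      have := hp3 k hk
      rw [add_mul, one_mul] at this
      omega
    · simp only [List.map_cons, hp2]
      congr 1
      rw [Nat.add_comm, Nat.add_mul_mod_self_right, Nat.mod_eq_of_lt hj]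
      simp [hj, hja]
    · intro k hk
      rcases List.mem_cons.1 hk with rfl | hk
      · omega
      · have := hp3 k hk
        rw [add_mul, one_mul] at this
        omega

theorem existsUnique_isSortingWord (cs : CoxeterSystem M W) {J : Set B} {c : List B}
    (hc : IsCoxeterWord J c) {w : W} (hw : w ∈ cs.parabolic J) :
    ∃! ω, cs.IsSortingWord J c w ω := by
  have hlen : ∀ {p ω}, IsSubwordAt c p ω → p.length = ω.length := fun h => by
    simpa using congrArg List.length h.2
  obtain ⟨ω₀, hω₀⟩ := cs.exists_isReducedExpr hw
  obtain ⟨p₀, hp₀⟩ := exists_isSubwordAt hc ω₀ hω₀.1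
  let P : Set (List ℕ) := {p | ∃ ω, IsSubwordAt c p ω ∧ cs.IsReducedExpr J w ω}
  have hP : P.Nonempty := ⟨p₀, ω₀, hp₀, hω₀⟩
  have wf : WellFounded (List.Shortlex (· < · : ℕ → ℕ → Prop)) :=
    List.Shortlex.wf Nat.lt_wfRel.wf
  obtain ⟨p, ⟨ω, hpω, hω⟩, hmin⟩ := wf.has_min P hP
  refine ⟨ω, ⟨hω, p, hpω, fun q ω' hq hω' => ?_⟩, ?_⟩
  · have hl : q.length = p.length := by
      rw [hlen hq, hlen hpω, hω.2.2, hω'.2.2]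
    by_contra hcon
    push Not at hcon
    refine hmin q ⟨ω', hq, hω'⟩ (List.Shortlex.of_lex hl ?_)
    rcases lt_trichotomy p q with h | h | h
    · exact absurd h hcon.2
    · exact absurd h hcon.1
    · exact h
  · rintro ω' ⟨hω', p', hp', hmin'⟩
    have h1 := hmin' p ω hpω hω
    have h2 : p' = p := by
      rcases h1 with h | h
      · exact h
      · exfalso
        refine hmin p' ⟨ω', hp', hω'⟩ (List.Shortlex.of_lex ?_ h)
        rw [hlen hp', hlen hpω, hω.2.2, hω'.2.2]
    subst h2
    have := hp'.2.symm.trans hpω.2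
    exact (List.map_injective_iff.2 (Option.some_injective B)) this

open Classical in
/-- The `c`-sorting word of `w ∈ W_J`; it exists and is unique by `existsUnique_isSortingWord`.
For `w` the longest element of `W_J` it is the word `w∘(c)`. -/
noncomputable def sortingWord (cs : CoxeterSystem M W) (J : Set B) (c : List B) (w : W) : List B :=
  if h : ∃ ω, cs.IsSortingWord J c w ω then h.choose else []

theorem isSortingWord_sortingWord (cs : CoxeterSystem M W) {J : Set B} {c : List B}
    (hc : IsCoxeterWord J c) {w : W} (hw : w ∈ cs.parabolic J) :
    cs.IsSortingWord J c w (cs.sortingWord J c w) := by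
  have h := (cs.existsUnique_isSortingWord hc hw).exists
  unfold sortingWord
  rw [dif_pos h]
  exact h.choose_spec

/-! ### Commutations -/

/-- `ω'` arises from `ω` by exchanging two consecutive commuting letters. -/
def CommStep (cs : CoxeterSystem M W) (ω ω' : List B) : Prop :=
  ∃ (x y : List B) (i j : B), Commute (cs.simple i) (cs.simple j) ∧
    ω = x ++ [i, j] ++ y ∧ ω' = x ++ [j, i] ++ y

/-- `ω` and `ω'` are equal up to commutations of consecutive commuting letters. -/
def CommEquiv (cs : CoxeterSystem M W) (ω ω' : List B) : Prop :=
  Relation.ReflTransGen cs.CommStep ω ω'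

end CoxeterSystem

open Classical in
/-- The sublist of the entries of `L` that lie in `S`, in the same order. -/
noncomputable def List.restrictTo {X : Type*} (L : List X) (S : Set X) : List X :=
  L.filter (fun x => x ∈ S)

/-! The commutation class of a word is determined by its set of inversions together with the
relative order of the non-orthogonal ones (`commEquiv_of_pairwise`). For the sorting word of a
longest element, this order is governed by the skew-symmetric form ω_c: if x precedes y in the
inversion list, then ω_c(x, y) ≥ 0, with equality only if x ⟂ y (`pairwise_orderRel_sortingWord`).
On the span of the simple roots in J, ω_c agrees with the form of the restricted word
(`coxForm_restrictTo`). Hence the sublist in Φ' and the inversion list of the sorting word for J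
obey the same order condition. Both enumerate the positive roots of Φ', and the sublist is itself
the inversion list of a word in J (`exists_restrictTo_inv_eq`), so the two words agree up to
commutations.

The order condition is proved by reading c^∞ letter by letter. Let s be the initial letter of c. If
s is used, one passes to s w and to the word with s moved to the end; s carries one form to the
other (`coxForm_rotate`), and ω_c(α_s, ·) ≥ 0 on positive roots. If s is skipped, moving it to the
end is harmless once all inversions of w have s-coordinate zero. This fails for general w but holds
for aligned elements (`SupportedOn.of_simpleRoot_notMem`). Longest elements are aligned because they
invert every positive root of their subsystem, and alignment passes to s w (`Aligned.simple_mul`).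
-/

namespace CoxeterSystem

variable {B W : Type*} [Group W] {M : CoxeterMatrix B}

namespace EuclideanRootSystem

variable {cs : CoxeterSystem M W} {V : Type*} [NormedAddCommGroup V] [InnerProductSpace ℝ V]
  (R : cs.EuclideanRootSystem V)

/-! ### The action on roots -/

/-- The coordinate of `x` along the simple root `αᵢ`. -/
noncomputable def coord (i : B) : V →ₗ[ℝ] ℝ := R.simpleRoot.coord i

theorem coord_ext {x y : V} (h : ∀ i, R.coord i x = R.coord i y) : x = y :=
  R.simpleRoot.ext_elem h

theorem coord_simpleRoot_self (i : B) : R.coord i (R.simpleRoot i) = 1 := by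
  simp [coord]

theorem coord_simpleRoot_ne {i j : B} (h : i ≠ j) : R.coord i (R.simpleRoot j) = 0 := by
  simp [coord, h.symm]

theorem act_mul (v w : W) (x : V) : R.act (v * w) x = R.act v (R.act w x) := by
  rw [map_mul]; rfl

theorem act_inv_act (w : W) (x : V) : R.act w⁻¹ (R.act w x) = x := by
  rw [← act_mul]; simp

theorem act_act_inv (w : W) (x : V) : R.act w (R.act w⁻¹ x) = x := by
  rw [← act_mul]; simp

theorem act_simple_act_simple (i : B) (x : V) :
    R.act (cs.simple i) (R.act (cs.simple i) x) = x := by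
  rw [← act_mul]; simp

theorem inner_simpleRoot_self_pos (i : B) : 0 < ⟪R.simpleRoot i, R.simpleRoot i⟫_ℝ :=
  real_inner_self_pos.2 (R.simpleRoot.ne_zero i)

theorem act_simple_simpleRoot (i : B) :
    R.act (cs.simple i) (R.simpleRoot i) = -R.simpleRoot i := by
  have := (R.inner_simpleRoot_self_pos i).ne'
  rw [R.act_simple, mul_div_assoc, div_self this]
  module

theorem coord_act_simple_ne {i j : B} (h : i ≠ j) (x : V) :
    R.coord i (R.act (cs.simple j) x) = R.coord i x := by
  rw [R.act_simple, map_sub, map_smul, coord_simpleRoot_ne R h]; simp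

theorem act_simple_of_inner_eq_zero {i : B} {x : V} (h : ⟪R.simpleRoot i, x⟫_ℝ = 0) :
    R.act (cs.simple i) x = x := by
  rw [R.act_simple, h]; simp

theorem inner_act_simple (i : B) (x y : V) :
    ⟪R.act (cs.simple i) x, R.act (cs.simple i) y⟫_ℝ = ⟪x, y⟫_ℝ := by
  have := (R.inner_simpleRoot_self_pos i).ne'
  rw [R.act_simple, R.act_simple]
  simp only [inner_sub_left, inner_sub_right, real_inner_smul_left, real_inner_smul_right]
  rw [real_inner_comm (R.simpleRoot i) x]
  field_simp
  ring

theorem act_wordProd_cons (a : B) (ω : List B) (x : V) :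
    R.act (cs.wordProd (a :: ω)) x = R.act (cs.simple a) (R.act (cs.wordProd ω) x) := by
  rw [cs.wordProd_cons, act_mul]

theorem inner_act (w : W) (x y : V) : ⟪R.act w x, R.act w y⟫_ℝ = ⟪x, y⟫_ℝ := by
  obtain ⟨ω, -, rfl⟩ := cs.exists_isReduced w
  induction ω with
  | nil => simp
  | cons a ω ih => rw [act_wordProd_cons, act_wordProd_cons, inner_act_simple, ih]

theorem act_mem_roots (w : W) {x : V} (hx : x ∈ R.roots) : R.act w x ∈ R.roots := by
  obtain ⟨ω, -, rfl⟩ := cs.exists_isReduced w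
  induction ω with
  | nil => simpa
  | cons a ω ih =>
    rw [act_wordProd_cons, R.act_simple]
    exact R.reflection_mem _ (R.simpleRoot_mem a) _ ih

theorem neg_mem_roots {x : V} (hx : x ∈ R.roots) : -x ∈ R.roots := by
  have h0 : x ≠ 0 := fun h => R.zero_notMem (h ▸ hx)
  have h := R.reflection_mem x hx x hx
  rw [mul_div_assoc, div_self (real_inner_self_pos.2 h0).ne'] at h
  convert h using 1
  module

/-- An element mapping the simple root `α_b` to `α_a` conjugates `s_b` to `s_a`. -/
theorem simple_mul_eq_mul_simple {w : W} {a b : B}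
    (h : R.act w (R.simpleRoot b) = R.simpleRoot a) : cs.simple a * w = w * cs.simple b := by
  apply R.act_injective
  ext v
  rw [act_mul, act_mul, R.act_simple, R.act_simple, map_sub, map_smul, h, ← h, R.inner_act,
    R.inner_act]

/-! ### Positive roots -/

/-- `x` is a positive root. -/
def IsPos (x : V) : Prop := x ∈ R.roots ∧ ∀ i, 0 ≤ R.coord i x

theorem isPos_simpleRoot (i : B) : R.IsPos (R.simpleRoot i) := by
  refine ⟨R.simpleRoot_mem i, fun j => ?_⟩
  by_cases h : j = i
  · subst h; simp [coord_simpleRoot_self]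
  · rw [coord_simpleRoot_ne R h]

theorem isPos_or_isPos_neg {x : V} (hx : x ∈ R.roots) : R.IsPos x ∨ R.IsPos (-x) := by
  rcases R.nonneg_or_nonpos x hx with h | h
  · exact Or.inl ⟨hx, h⟩
  · refine Or.inr ⟨R.neg_mem_roots hx, fun i => ?_⟩
    have : R.coord i x ≤ 0 := h i
    rw [map_neg]; linarith

variable {R}

theorem IsPos.ne_zero {x : V} (hx : R.IsPos x) : x ≠ 0 := fun h => R.zero_notMem (h ▸ hx.1)

theorem IsPos.not_isPos_neg {x : V} (hx : R.IsPos x) : ¬ R.IsPos (-x) := by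
  intro h
  apply hx.ne_zero
  refine R.coord_ext fun i => ?_
  have h1 := hx.2 i
  have h2 := h.2 i
  rw [map_neg] at h2
  rw [map_zero]; linarith

theorem isPos_of_coord_pos {x : V} (hx : x ∈ R.roots) {i : B} (hi : 0 < R.coord i x) :
    R.IsPos x := by
  rcases R.isPos_or_isPos_neg hx with h | h
  · exact h
  · have := h.2 i
    rw [map_neg] at this; linarith

/-- A positive root all of whose coordinates away from `s` vanish is `α_s`. -/
theorem IsPos.eq_simpleRoot {x : V} (hx : R.IsPos x) {s : B} (h : ∀ i, i ≠ s → R.coord i x = 0) :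
    x = R.simpleRoot s := by
  have h1 : x = R.coord s x • R.simpleRoot s := by
    refine R.coord_ext fun i => ?_
    by_cases hi : i = s
    · subst hi; simp [coord_simpleRoot_self]
    · rw [h i hi, map_smul, coord_simpleRoot_ne R hi]; simp
  have h2 := hx.1
  rw [h1] at h2
  rcases R.eq_or_eq_neg _ (R.simpleRoot_mem s) _ h2 with h3 | h3
  · rw [h1, h3, one_smul]
  · have := hx.2 s
    linarith

theorem IsPos.exists_coord_pos {x : V} (hx : R.IsPos x) {s : B} (h : x ≠ R.simpleRoot s) :
    ∃ i, i ≠ s ∧ 0 < R.coord i x := by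
  by_contra hcon
  push Not at hcon
  exact h (hx.eq_simpleRoot fun i hi => le_antisymm (hcon i hi) (hx.2 i))

theorem IsPos.act_simple {x : V} (hx : R.IsPos x) {s : B} (h : x ≠ R.simpleRoot s) :
    R.IsPos (R.act (cs.simple s) x) := by
  obtain ⟨i, hi, hp⟩ := hx.exists_coord_pos h
  refine isPos_of_coord_pos (R.act_mem_roots _ hx.1) (i := i) ?_
  rwa [coord_act_simple_ne R hi]

theorem IsPos.of_eq_combination {x y z : V} {a b : ℝ} (hx : R.IsPos x) (hy : R.IsPos y)
    (ha : 0 ≤ a) (hb : 0 ≤ b) (hz : z ∈ R.roots) (h : z = a • x + b • y) : R.IsPos z := by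
  refine ⟨hz, fun i => ?_⟩
  rw [h, map_add, map_smul, map_smul]
  exact add_nonneg (mul_nonneg ha (hx.2 i)) (mul_nonneg hb (hy.2 i))

variable (R)

/-- The root sᵢ(αⱼ) is positive, and its i-th coordinate is -2⟪αᵢ, αⱼ⟫/⟪αᵢ, αᵢ⟫. -/
theorem inner_simpleRoot_nonpos {i j : B} (h : i ≠ j) :
    ⟪R.simpleRoot i, R.simpleRoot j⟫_ℝ ≤ 0 := by
  have h1 := ((R.isPos_simpleRoot j).act_simple (s := i)
    (fun e => h (R.simpleRoot.injective e).symm)).2 i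
  rw [R.act_simple, map_sub, map_smul, coord_simpleRoot_ne R h, coord_simpleRoot_self] at h1
  have h2 := R.inner_simpleRoot_self_pos i
  by_contra hcon
  push Not at hcon
  have : 0 < 2 * ⟪R.simpleRoot i, R.simpleRoot j⟫_ℝ / ⟪R.simpleRoot i, R.simpleRoot i⟫_ℝ := by
    positivity
  rw [smul_eq_mul, mul_one] at h1
  linarith

theorem coord_act_wordProd {i : B} {ω : List B} (h : i ∉ ω) (x : V) :
    R.coord i (R.act (cs.wordProd ω) x) = R.coord i x := by
  induction ω with
  | nil => simp
  | cons a ω ih =>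
    rw [List.mem_cons, not_or] at h
    rw [act_wordProd_cons, coord_act_simple_ne R h.1, ih h.2]

/-- Reflections in other letters leave the s-coordinate at 1, and one positive coordinate decides
the sign of a root. -/
theorem isPos_act_wordProd_simpleRoot {s : B} {ω : List B} (h : s ∉ ω) :
    R.IsPos (R.act (cs.wordProd ω) (R.simpleRoot s)) := by
  refine isPos_of_coord_pos (R.act_mem_roots _ (R.simpleRoot_mem s)) (i := s) ?_
  rw [coord_act_wordProd R h, coord_simpleRoot_self]
  exact one_pos

/-! ### Inversion sets and inversion lists -/

/-- The set of inversions of `w`: the positive roots made negative by `w⁻¹`. -/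
def invSet (w : W) : Set V := {x | R.IsPos x ∧ R.IsPos (-R.act w⁻¹ x)}

theorem mem_invSet_simple_mul_iff {s : B} {w : W} {x : V} :
    x ∈ R.invSet (cs.simple s * w) ↔
      R.IsPos x ∧ R.IsPos (-R.act w⁻¹ (R.act (cs.simple s) x)) := by
  simp only [invSet, Set.mem_ofPred_eq, mul_inv_rev, cs.inv_simple, act_mul]

theorem isPos_act_inv_of_notMem_invSet {w : W} {x : V} (hx : R.IsPos x) (h : x ∉ R.invSet w) :
    R.IsPos (R.act w⁻¹ x) :=
  (R.isPos_or_isPos_neg (R.act_mem_roots _ hx.1)).resolve_right fun h' => h ⟨hx, h'⟩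

theorem finite_invSet (w : W) : (R.invSet w).Finite :=
  R.finite_roots.subset fun _ hx => hx.1.1

@[simp] theorem inv_nil : R.inv [] = [] := rfl

theorem inv_cons (a : B) (ω : List B) :
    R.inv (a :: ω) = R.simpleRoot a :: (R.inv ω).map (R.act (cs.simple a)) := by
  unfold inv
  rw [List.map_ofFn]
  simp only [List.length_cons, List.ofFn_succ]
  congr 1
  · simp
  · congr 1
    funext k
    simp [cs.wordProd_cons]

@[simp] theorem length_inv (ω : List B) : (R.inv ω).length = ω.length := by
  simp [inv]

theorem inv_append (ω ω' : List B) :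
    R.inv (ω ++ ω') = R.inv ω ++ (R.inv ω').map (R.act (cs.wordProd ω)) := by
  induction ω with
  | nil => simp [Module.End.one_eq_id]
  | cons a ω ih =>
    rw [List.cons_append, inv_cons, inv_cons, ih]
    simp [Function.comp_def, act_wordProd_cons]

theorem inv_append_singleton (ω : List B) (a : B) :
    R.inv (ω ++ [a]) = R.inv ω ++ [R.act (cs.wordProd ω) (R.simpleRoot a)] := by
  rw [inv_append, inv_cons]; simp

/-- Every inversion of the product of a word is in its inversion list. -/
theorem exists_of_mem_invSet_wordProd {ω : List B} {x : V} (hx : x ∈ R.invSet (cs.wordProd ω)) :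
    ∃ y a z, ω = y ++ a :: z ∧ R.act (cs.wordProd y) (R.simpleRoot a) = x := by
  induction ω generalizing x with
  | nil =>
    have h := hx.2
    simp only [cs.wordProd_nil, inv_one, map_one, Module.End.one_apply] at h
    exact absurd h hx.1.not_isPos_neg
  | cons a ω ih =>
    by_cases hxa : x = R.simpleRoot a
    · exact ⟨[], a, ω, rfl, by simp [hxa]⟩
    · rw [cs.wordProd_cons, mem_invSet_simple_mul_iff] at hx
      obtain ⟨y, b, z, rfl, h⟩ := ih ⟨hx.1.act_simple hxa, hx.2⟩
      refine ⟨a :: y, b, z, rfl, ?_⟩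
      rw [act_wordProd_cons, h, act_simple_act_simple]

theorem mem_inv_of_eq_append (y : List B) (a : B) (z : List B) :
    R.act (cs.wordProd y) (R.simpleRoot a) ∈ R.inv (y ++ a :: z) := by
  rw [inv_append, inv_cons]; simp

theorem exists_of_mem_inv {ω : List B} {x : V} (hx : x ∈ R.inv ω) :
    ∃ y a z, ω = y ++ a :: z ∧ R.act (cs.wordProd y) (R.simpleRoot a) = x := by
  induction ω generalizing x with
  | nil => simp at hx
  | cons a ω ih =>
    rw [inv_cons, List.mem_cons] at hx
    rcases hx with rfl | hx
    · exact ⟨[], a, ω, rfl, by simp⟩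
    · obtain ⟨x', hx', rfl⟩ := List.mem_map.1 hx
      obtain ⟨y, b, z, rfl, rfl⟩ := ih hx'
      exact ⟨a :: y, b, z, rfl, by rw [act_wordProd_cons]⟩

theorem mem_inv_of_mem_invSet {ω : List B} {x : V} (hx : x ∈ R.invSet (cs.wordProd ω)) :
    x ∈ R.inv ω := by
  obtain ⟨y, a, z, rfl, rfl⟩ := R.exists_of_mem_invSet_wordProd hx
  exact R.mem_inv_of_eq_append y a z

/-- All inversions in the inversion list of `ω` are positive roots; this holds if and only if `ω`
is reduced. -/
def PosWord (ω : List B) : Prop := ∀ x ∈ R.inv ω, R.IsPos x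

variable {R}

theorem PosWord.tail_notMem {a : B} {ω : List B} (h : R.PosWord (a :: ω)) :
    R.simpleRoot a ∉ R.inv ω := fun hx => by
  have h1 := h (R.act (cs.simple a) (R.simpleRoot a)) (by
    rw [inv_cons]
    exact List.mem_cons_of_mem _ (List.mem_map_of_mem hx))
  rw [act_simple_simpleRoot] at h1
  exact (R.isPos_simpleRoot a).not_isPos_neg h1

theorem PosWord.tail {a : B} {ω : List B} (h : R.PosWord (a :: ω)) : R.PosWord ω := by
  intro x hx
  obtain ⟨y, b, z, rfl, rfl⟩ := R.exists_of_mem_inv hx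
  refine (R.isPos_or_isPos_neg
    (R.act_mem_roots (cs.wordProd y) (R.simpleRoot_mem b))).resolve_right fun h' => ?_
  have h1 : R.IsPos (R.act (cs.simple a) (R.act (cs.wordProd y) (R.simpleRoot b))) := by
    apply h
    rw [inv_cons]
    exact List.mem_cons_of_mem _ (List.mem_map_of_mem hx)
  -- The only positive root that s_a makes negative is α_a. In that case α_a already occurs in the
  -- inversion list of y, which `tail_notMem` forbids.
  by_cases hy : -R.act (cs.wordProd y) (R.simpleRoot b) = R.simpleRoot a
  · have h2 : R.simpleRoot a ∈ R.invSet (cs.wordProd y) := by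
      refine ⟨R.isPos_simpleRoot a, ?_⟩
      rw [← hy, map_neg, act_inv_act, neg_neg]
      exact R.isPos_simpleRoot b
    apply h.tail_notMem
    rw [inv_append]
    exact List.mem_append_left _ (R.mem_inv_of_mem_invSet h2)
  · have := h'.act_simple hy
    rw [map_neg] at this
    exact absurd this h1.not_isPos_neg

theorem posWord_nil : R.PosWord [] := by simp [PosWord]

theorem PosWord.mem_inv_iff {ω : List B} (h : R.PosWord ω) {x : V} :
    x ∈ R.inv ω ↔ x ∈ R.invSet (cs.wordProd ω) := by
  refine ⟨fun hx => ?_, R.mem_inv_of_mem_invSet⟩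
  induction ω generalizing x with
  | nil => simp at hx
  | cons a ω ih =>
    have hpos := h x hx
    rw [cs.wordProd_cons, mem_invSet_simple_mul_iff]
    refine ⟨hpos, ?_⟩
    rw [inv_cons, List.mem_cons] at hx
    rcases hx with rfl | hx
    · rw [act_simple_simpleRoot, map_neg, neg_neg]
      exact R.isPos_act_inv_of_notMem_invSet (R.isPos_simpleRoot a)
        fun h' => h.tail_notMem (R.mem_inv_of_mem_invSet h')
    · obtain ⟨x, hx', rfl⟩ := List.mem_map.1 hx
      rw [act_simple_act_simple]
      exact (ih h.tail hx').2

theorem PosWord.nodup {ω : List B} (h : R.PosWord ω) : (R.inv ω).Nodup := by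
  induction ω with
  | nil => simp
  | cons a ω ih =>
    rw [inv_cons, List.nodup_cons]
    refine ⟨fun hx => ?_, (ih h.tail).map (Function.LeftInverse.injective
      (R.act_simple_act_simple a))⟩
    obtain ⟨x, hx, hxa⟩ := List.mem_map.1 hx
    have h1 : x = -R.simpleRoot a := by
      rw [← act_simple_simpleRoot, ← hxa, act_simple_act_simple]
    exact (R.isPos_simpleRoot a).not_isPos_neg (h1 ▸ h.tail x hx)

theorem PosWord.cons {a : B} {ω : List B} (h : R.PosWord ω)
    (ha : R.simpleRoot a ∉ R.invSet (cs.wordProd ω)) : R.PosWord (a :: ω) := by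
  intro x hx
  rw [inv_cons, List.mem_cons] at hx
  rcases hx with rfl | hx
  · exact R.isPos_simpleRoot a
  · obtain ⟨x, hx', rfl⟩ := List.mem_map.1 hx
    refine (h x hx').act_simple ?_
    rintro rfl
    exact ha (h.mem_inv_iff.1 hx')

/-- The inversion list has no repetitions, so the length is a quantity depending only on the group
element. With `ncard_invSet_le` this makes such words shortest, in whichever generators length is
measured. -/
theorem PosWord.length_eq {ω : List B} (h : R.PosWord ω) :
    ω.length = (R.invSet (cs.wordProd ω)).ncard := by
  classical
  have : R.invSet (cs.wordProd ω) = ((R.inv ω).toFinset : Set V) := by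
    ext x
    simp [h.mem_inv_iff]
  rw [this, Set.ncard_coe_finset, List.toFinset_card_of_nodup h.nodup, length_inv]

variable (R) in
theorem ncard_invSet_le (ω : List B) : (R.invSet (cs.wordProd ω)).ncard ≤ ω.length := by
  classical
  have : R.invSet (cs.wordProd ω) ⊆ ((R.inv ω).toFinset : Set V) := fun x hx => by
    simpa using R.mem_inv_of_mem_invSet hx
  refine (Set.ncard_le_ncard this (Finset.finite_toSet _)).trans ?_
  rw [Set.ncard_coe_finset]
  exact (List.toFinset_card_le _).trans_eq (R.length_inv ω)

/-- If `α_a` is an inversion of the product of `ω`, a letter of `ω` can be exchanged for a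
first letter `a`. -/
theorem exists_wordProd_cons_eq {a : B} {ω : List B}
    (h : R.simpleRoot a ∈ R.invSet (cs.wordProd ω)) :
    ∃ y b z, ω = y ++ b :: z ∧ cs.wordProd (a :: ω) = cs.wordProd (y ++ z) := by
  obtain ⟨y, b, z, rfl, hy⟩ := R.exists_of_mem_invSet_wordProd h
  refine ⟨y, b, z, rfl, ?_⟩
  rw [cs.wordProd_cons, cs.wordProd_append, cs.wordProd_append, cs.wordProd_cons, ← mul_assoc,
    simple_mul_eq_mul_simple R hy, mul_assoc, cs.simple_mul_simple_cancel_left]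

/-! ### Reduced expressions in a standard parabolic subgroup -/

theorem parabolicLength_le {J : Set B} {ω : List B} (h : ∀ i ∈ ω, i ∈ J) :
    cs.parabolicLength J (cs.wordProd ω) ≤ ω.length :=
  Nat.sInf_le ⟨ω, h, rfl, rfl⟩

theorem wordProd_mem_parabolic {J : Set B} {ω : List B} (h : ∀ i ∈ ω, i ∈ J) :
    cs.wordProd ω ∈ cs.parabolic J := by
  induction ω with
  | nil => simp
  | cons a ω ih =>
    rw [cs.wordProd_cons]
    exact mul_mem (Subgroup.subset_closure ⟨a, h a (by simp), rfl⟩)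
      (ih fun i hi => h i (by simp [hi]))

theorem _root_.CoxeterSystem.IsReducedExpr.tail {J : Set B} {a : B} {ω : List B}
    (h : cs.IsReducedExpr J (cs.wordProd (a :: ω)) (a :: ω)) :
    cs.IsReducedExpr J (cs.wordProd ω) ω := by
  have hJ : ∀ i ∈ ω, i ∈ J := fun i hi => h.1 i (by simp [hi])
  refine ⟨hJ, rfl, le_antisymm ?_ (parabolicLength_le hJ)⟩
  obtain ⟨ω', h1, h2, h3⟩ := cs.exists_isReducedExpr (wordProd_mem_parabolic hJ)
  have h4 := parabolicLength_le (cs := cs) (J := J) (ω := a :: ω') (by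
    simpa using ⟨h.1 a (by simp), h1⟩)
  rw [cs.wordProd_cons, h2, ← cs.wordProd_cons, ← h.2.2] at h4
  simp at h4
  omega

/-- If α_a were an inversion of the tail, the exchange property would give an expression in J
shorter by two letters. -/
theorem _root_.CoxeterSystem.IsReducedExpr.posWord {J : Set B} {w : W} {ω : List B}
    (h : cs.IsReducedExpr J w ω) : R.PosWord ω := by
  obtain rfl := h.2.1
  induction ω with
  | nil => exact posWord_nil
  | cons a ω ih =>
    refine (ih h.tail).cons fun h' => ?_
    obtain ⟨y, b, z, rfl, he⟩ := exists_wordProd_cons_eq h'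
    have h4 := parabolicLength_le (cs := cs) (J := J) (ω := y ++ z) fun i hi =>
      h.1 i (by simp at hi ⊢; tauto)
    rw [← he, ← h.2.2] at h4
    simp at h4

theorem PosWord.isReducedExpr {J : Set B} {ω : List B} (h : R.PosWord ω) (hJ : ∀ i ∈ ω, i ∈ J) :
    cs.IsReducedExpr J (cs.wordProd ω) ω := by
  refine ⟨hJ, rfl, le_antisymm ?_ (parabolicLength_le hJ)⟩
  obtain ⟨ω', h1, h2, h3⟩ := cs.exists_isReducedExpr (wordProd_mem_parabolic hJ)
  rw [← h3, h.length_eq, ← h2]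
  exact R.ncard_invSet_le ω'

variable (R) in
theorem exists_posWord (w : W) : ∃ ω, R.PosWord ω ∧ cs.wordProd ω = w := by
  obtain ⟨ω, -, rfl⟩ := cs.exists_isReduced w
  obtain ⟨ω', h⟩ := cs.exists_isReducedExpr (J := Set.univ) (w := cs.wordProd ω)
    (wordProd_mem_parabolic (by simp))
  exact ⟨ω', h.posWord, h.2.1⟩

theorem eq_one_of_invSet_eq_empty {w : W} (h : R.invSet w = ∅) : w = 1 := by
  obtain ⟨ω, hω, rfl⟩ := R.exists_posWord w
  have := hω.length_eq
  rw [h, Set.ncard_empty, List.length_eq_zero_iff] at this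
  simp [this]

end EuclideanRootSystem
end CoxeterSystem

namespace CoxeterSystem

variable {B W : Type*} [Group W] {M : CoxeterMatrix B}

namespace EuclideanRootSystem

variable {cs : CoxeterSystem M W} {V : Type*} [NormedAddCommGroup V] [InnerProductSpace ℝ V]
  {R : cs.EuclideanRootSystem V}

/-! ### Parabolic root subsystems -/

theorem mem_parabolicRoots_iff {J : Set B} {x : V} :
    x ∈ R.parabolicRoots J ↔ x ∈ R.roots ∧ ∀ i ∉ J, R.coord i x = 0 := by
  unfold parabolicRoots
  rw [Set.mem_inter_iff, SetLike.mem_coe, Module.Basis.mem_span_image]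
  refine and_congr_right fun _ => ⟨fun h i hi => ?_, fun h i hi => ?_⟩
  · by_contra hcon
    exact hi (h (by simpa [coord] using hcon))
  · by_contra hcon
    have := h i hcon
    simp at hi
    exact hi this

theorem simpleRoot_mem_parabolicRoots_iff {J : Set B} {i : B} :
    R.simpleRoot i ∈ R.parabolicRoots J ↔ i ∈ J := by
  rw [mem_parabolicRoots_iff]
  refine ⟨fun h => ?_, fun h => ⟨R.simpleRoot_mem i, fun j hj => coord_simpleRoot_ne R ?_⟩⟩
  · by_contra hi
    have := h.2 i hi
    rw [coord_simpleRoot_self] at this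
    exact one_ne_zero this
  · rintro rfl
    exact hj h

theorem neg_mem_parabolicRoots {J : Set B} {x : V} (hx : x ∈ R.parabolicRoots J) :
    -x ∈ R.parabolicRoots J := by
  rw [mem_parabolicRoots_iff] at hx ⊢
  exact ⟨R.neg_mem_roots hx.1, fun i hi => by rw [map_neg, hx.2 i hi, neg_zero]⟩

theorem act_simple_mem_parabolicRoots_iff {J : Set B} {j : B} (hj : j ∈ J) {x : V} :
    R.act (cs.simple j) x ∈ R.parabolicRoots J ↔ x ∈ R.parabolicRoots J := by
  have key : ∀ y, y ∈ R.parabolicRoots J → R.act (cs.simple j) y ∈ R.parabolicRoots J := by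
    intro y hy
    rw [mem_parabolicRoots_iff] at hy ⊢
    refine ⟨R.act_mem_roots _ hy.1, fun i hi => ?_⟩
    rw [coord_act_simple_ne R (by rintro rfl; exact hi hj), hy.2 i hi]
  refine ⟨fun h => ?_, key x⟩
  rw [← R.act_simple_act_simple j x]
  exact key _ h

theorem act_wordProd_mem_parabolicRoots_iff {J : Set B} {ω : List B} (h : ∀ i ∈ ω, i ∈ J)
    {x : V} : R.act (cs.wordProd ω) x ∈ R.parabolicRoots J ↔ x ∈ R.parabolicRoots J := by
  induction ω with
  | nil => simp
  | cons a ω ih =>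
    rw [act_wordProd_cons, act_simple_mem_parabolicRoots_iff (h a (by simp)),
      ih fun i hi => h i (by simp [hi])]

theorem mem_parabolicRoots_of_mem_inv {J : Set B} {ω : List B} (h : ∀ i ∈ ω, i ∈ J)
    {x : V} (hx : x ∈ R.inv ω) : x ∈ R.parabolicRoots J := by
  obtain ⟨y, a, z, rfl, rfl⟩ := R.exists_of_mem_inv hx
  rw [act_wordProd_mem_parabolicRoots_iff fun i hi => h i (by simp [hi]),
    simpleRoot_mem_parabolicRoots_iff]
  exact h a (by simp)

theorem mem_of_inv_subset_parabolicRoots {J : Set B} {ω : List B}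
    (h : ∀ x ∈ R.inv ω, x ∈ R.parabolicRoots J) : ∀ i ∈ ω, i ∈ J := by
  induction ω with
  | nil => simp
  | cons a ω ih =>
    rw [inv_cons] at h
    have ha : a ∈ J := simpleRoot_mem_parabolicRoots_iff.1 (h _ (by simp))
    have := ih fun x hx => (act_simple_mem_parabolicRoots_iff ha).1
      (h _ (List.mem_cons_of_mem _ (List.mem_map_of_mem hx)))
    simpa using ⟨ha, this⟩

/-- The inversion set of the longest element of `W_J` consists of all positive roots of the root
subsystem. -/
theorem _root_.CoxeterSystem.IsLongest.invSet_eq {J : Set B} {w : W} (h : cs.IsLongest J w) :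
    R.invSet w = {x | R.IsPos x ∧ x ∈ R.parabolicRoots J} := by
  obtain ⟨ω, hω⟩ := cs.exists_isReducedExpr h.1
  obtain rfl := hω.2.1
  have hpos : R.PosWord ω := hω.posWord
  have hs : ∀ j ∈ J, R.simpleRoot j ∈ R.invSet (cs.wordProd ω) := by
    intro j hj
    by_contra hcon
    -- If αⱼ were not inverted, prepending j would give a longer element of W_J.
    have hr := (hpos.cons hcon).isReducedExpr (J := J) (by simpa using ⟨hj, hω.1⟩)
    have hle := h.2 _ (wordProd_mem_parabolic hr.1)
    rw [← hr.2.2, ← hω.2.2] at hle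
    simp at hle
  ext x
  refine ⟨fun hx => ⟨hx.1, mem_parabolicRoots_of_mem_inv hω.1 (hpos.mem_inv_iff.2 hx)⟩, ?_⟩
  rintro ⟨hx, hxJ⟩
  refine ⟨hx, R.neg_mem_roots (R.act_mem_roots _ hx.1), fun i => ?_⟩
  have hmem := hxJ.2
  rw [mem_parabolicRoots_iff] at hxJ
  have hsum : x = ∑ j ∈ (R.simpleRoot.repr x).support, R.coord j x • R.simpleRoot j := by
    conv_lhs => rw [← R.simpleRoot.linearCombination_repr x]
    rfl
  -- x is a nonnegative combination of the αⱼ with j ∈ J, each of which w⁻¹ makes negative.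
  rw [hsum, map_sum, map_neg, map_sum, ← Finset.sum_neg_distrib]
  refine Finset.sum_nonneg fun j hj => ?_
  have hjJ : j ∈ J := by
    by_contra hcon
    exact (Finsupp.mem_support_iff.1 hj) (hxJ.2 j hcon)
  have h1 := (hs j hjJ).2.2 i
  rw [map_neg] at h1
  rw [map_smul, map_smul, smul_eq_mul, ← mul_neg]
  exact mul_nonneg (hx.2 j) h1

/-- Simple roots are indecomposable: if `g` maps the positive roots of a parabolic subsystem to
positive roots and a positive root `x` of that subsystem to a simple root, then `x` is simple. -/
theorem exists_eq_simpleRoot {J : Set B} {g : W} {p : B} {x : V}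
    (hg : ∀ y ∈ R.parabolicRoots J, R.IsPos y → R.IsPos (R.act g y))
    (hx : R.IsPos x) (hxJ : x ∈ R.parabolicRoots J) (h : R.act g x = R.simpleRoot p) :
    ∃ j ∈ J, x = R.simpleRoot j := by
  have hsum : x = ∑ j ∈ (R.simpleRoot.repr x).support, R.coord j x • R.simpleRoot j := by
    conv_lhs => rw [← R.simpleRoot.linearCombination_repr x]
    rfl
  have hmem : ∀ j ∈ (R.simpleRoot.repr x).support, j ∈ J ∧ 0 < R.coord j x := by
    intro j hj
    have hne : R.coord j x ≠ 0 := Finsupp.mem_support_iff.1 hj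
    refine ⟨?_, lt_of_le_of_ne (hx.2 j) hne.symm⟩
    by_contra hcon
    exact hne ((mem_parabolicRoots_iff.1 hxJ).2 j hcon)
  have hgp : ∀ j ∈ (R.simpleRoot.repr x).support,
      R.act g (R.simpleRoot j) = R.simpleRoot p := by
    intro j hj
    have hpos : ∀ k ∈ (R.simpleRoot.repr x).support, R.IsPos (R.act g (R.simpleRoot k)) :=
      fun k hk => hg _ (simpleRoot_mem_parabolicRoots_iff.2 (hmem k hk).1)
        (R.isPos_simpleRoot k)
    refine (hpos j hj).eq_simpleRoot fun i hi => ?_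
    -- Away from p the coordinates of g x vanish. They are sums of nonnegative terms, so every term
    -- vanishes and each g(αₖ) must be α_p.
    have h0 : ∑ k ∈ (R.simpleRoot.repr x).support,
        R.coord k x * R.coord i (R.act g (R.simpleRoot k)) = 0 := by
      rw [← coord_simpleRoot_ne R hi, ← h]
      conv_rhs => rw [hsum]
      simp only [map_sum, map_smul, smul_eq_mul]
    rw [Finset.sum_eq_zero_iff_of_nonneg fun k hk =>
      mul_nonneg (hmem k hk).2.le ((hpos k hk).2 i)] at h0
    exact (mul_eq_zero.1 (h0 j hj)).resolve_left (hmem j hj).2.ne'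
  obtain ⟨j, hj⟩ : (R.simpleRoot.repr x).support.Nonempty := by
    rw [Finset.nonempty_iff_ne_empty]
    intro he
    rw [he, Finset.sum_empty] at hsum
    exact hx.ne_zero hsum
  refine ⟨j, (hmem j hj).1, ?_⟩
  rw [← R.act_inv_act g x, h, ← hgp j hj, act_inv_act]

/-! ### Restricting inversion lists to a parabolic subsystem -/

theorem restrictTo_cons_of_mem {X : Type*} {a : X} (L : List X) {S : Set X} (h : a ∈ S) :
    (a :: L).restrictTo S = a :: L.restrictTo S := by
  simp [List.restrictTo, h]

theorem restrictTo_cons_of_notMem {X : Type*} {a : X} (L : List X) {S : Set X} (h : a ∉ S) :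
    (a :: L).restrictTo S = L.restrictTo S := by
  simp [List.restrictTo, h]

theorem mem_restrictTo {X : Type*} {a : X} {L : List X} {S : Set X} :
    a ∈ L.restrictTo S ↔ a ∈ L ∧ a ∈ S := by
  simp [List.restrictTo]

theorem restrictTo_sublist {X : Type*} (L : List X) (S : Set X) :
    (L.restrictTo S).Sublist L := List.filter_sublist

/-- The restriction of an inversion list to a parabolic subsystem, for a translate by a minimal
coset representative `g`. -/
theorem exists_restrictTo_map_inv_eq {J : Set B} (ω : List B) (g : W)
    (hg : ∀ y ∈ R.parabolicRoots J, R.IsPos y → R.IsPos (R.act g⁻¹ y)) :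
    ∃ u : List B, (∀ i ∈ u, i ∈ J) ∧
      ((R.inv ω).map (R.act g)).restrictTo (R.parabolicRoots J) = R.inv u := by
  induction ω generalizing g with
  | nil => exact ⟨[], by simp, by simp [List.restrictTo]⟩
  | cons p ω ih =>
    have hmap : ((R.inv (p :: ω)).map (R.act g)) = R.act g (R.simpleRoot p) ::
        (R.inv ω).map (R.act (g * cs.simple p)) := by
      rw [inv_cons]
      simp [Function.comp_def]
    rw [hmap]
    by_cases hp : R.act g (R.simpleRoot p) ∈ R.parabolicRoots J
    · have hpos : R.IsPos (R.act g (R.simpleRoot p)) := by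
        refine (R.isPos_or_isPos_neg hp.1).resolve_right fun h' => ?_
        have := hg _ (neg_mem_parabolicRoots hp) h'
        rw [map_neg, act_inv_act] at this
        exact (R.isPos_simpleRoot p).not_isPos_neg this
      -- Since g(α_p) is a simple root αⱼ of J, one has g s_p = sⱼ g: the letter j is emitted and
      -- the same g serves for the rest.
      obtain ⟨j, hj, he⟩ := exists_eq_simpleRoot hg hpos hp (R.act_inv_act g _)
      obtain ⟨u, hu, hu'⟩ := ih g hg
      refine ⟨j :: u, by simpa using ⟨hj, hu⟩, ?_⟩
      rw [restrictTo_cons_of_mem _ hp, inv_cons, ← hu', he, ← R.simple_mul_eq_mul_simple he]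
      congr 1
      unfold List.restrictTo
      rw [List.filter_map, List.filter_map, List.map_map]
      congr 1
      · funext x; simp
      · refine List.filter_congr fun x _ => ?_
        simp [act_simple_mem_parabolicRoots_iff hj]
    · rw [restrictTo_cons_of_notMem _ hp]
      -- The representative becomes g s_p. It still has the required property, because g⁻¹ y = α_p
      -- would put g(α_p) into the subsystem.
      refine ih _ fun y hy hpos => ?_
      rw [mul_inv_rev, cs.inv_simple, act_mul]
      refine (hg y hy hpos).act_simple fun h => hp ?_
      rwa [← h, act_act_inv]

theorem exists_restrictTo_inv_eq (J : Set B) (ω : List B) :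
    ∃ u : List B, (∀ i ∈ u, i ∈ J) ∧ (R.inv ω).restrictTo (R.parabolicRoots J) = R.inv u := by
  have := exists_restrictTo_map_inv_eq (R := R) (J := J) ω 1 (by simp)
  simpa [Module.End.one_eq_id] using this

/-! ### Commutation classes -/

theorem _root_.CoxeterSystem.CommEquiv.cons {ω ω' : List B} (h : cs.CommEquiv ω ω') (a : B) :
    cs.CommEquiv (a :: ω) (a :: ω') := by
  unfold CommEquiv at *
  refine Relation.ReflTransGen.lift (p := cs.CommStep) (a :: ·) ?_ _ _ h
  rintro _ _ ⟨x, y, i, j, hij, rfl, rfl⟩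
  exact ⟨a :: x, y, i, j, hij, rfl, rfl⟩

theorem commEquiv_cons_append {a : B} {x : List B}
    (h : ∀ b ∈ x, Commute (cs.simple a) (cs.simple b)) (y : List B) :
    cs.CommEquiv (a :: (x ++ y)) (x ++ a :: y) := by
  induction x with
  | nil => exact Relation.ReflTransGen.refl
  | cons b x ih =>
    refine Relation.ReflTransGen.head (b := b :: a :: (x ++ y)) ?_ ?_
    · exact ⟨[], x ++ y, a, b, h b (by simp), rfl, rfl⟩
    · exact (ih fun b' hb' => h b' (by simp [hb'])).cons b

theorem commute_of_inner_eq_zero {a b : B}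
    (h : ⟪R.simpleRoot a, R.simpleRoot b⟫_ℝ = 0) : Commute (cs.simple a) (cs.simple b) :=
  (R.simple_mul_eq_mul_simple (R.act_simple_of_inner_eq_zero
    (by rw [real_inner_comm]; exact h)))

/-- If `α_a` is orthogonal to all inversions of a word, it is orthogonal to all of its letters. -/
theorem inner_simpleRoot_eq_zero {a : B} {x : List B}
    (h : ∀ γ ∈ R.inv x, ⟪R.simpleRoot a, γ⟫_ℝ = 0) :
    ∀ b ∈ x, ⟪R.simpleRoot a, R.simpleRoot b⟫_ℝ = 0 := by
  induction x with
  | nil => simp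
  | cons b x ih =>
    rw [inv_cons] at h
    have hb : ⟪R.simpleRoot a, R.simpleRoot b⟫_ℝ = 0 := h _ (by simp)
    have : ∀ b' ∈ x, ⟪R.simpleRoot a, R.simpleRoot b'⟫_ℝ = 0 := ih fun γ hγ => by
      have := h _ (List.mem_cons_of_mem _ (List.mem_map_of_mem hγ))
      rw [← R.inner_act_simple b, act_simple_act_simple,
        R.act_simple_of_inner_eq_zero (by rw [real_inner_comm]; exact hb)] at this
      exact this
    simpa using ⟨hb, this⟩

theorem act_wordProd_eq_self {a : B} {x : List B}
    (h : ∀ b ∈ x, ⟪R.simpleRoot a, R.simpleRoot b⟫_ℝ = 0) :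
    R.act (cs.wordProd x) (R.simpleRoot a) = R.simpleRoot a := by
  induction x with
  | nil => simp
  | cons b x ih =>
    rw [act_wordProd_cons, ih fun b' hb' => h b' (by simp [hb']),
      R.act_simple_of_inner_eq_zero (by rw [real_inner_comm]; exact h b (by simp))]

/-- Two words are equal up to commutations if they have the same inversions and non-orthogonal
inversions occur in the same order. -/
theorem commEquiv_of_pairwise {u v : List B} {r : V → V → Prop}
    (hr : ∀ x y, r x y → r y x → ⟪x, y⟫_ℝ = 0) (hp : (R.inv u).Perm (R.inv v))
    (hu : (R.inv u).Pairwise r) (hv : (R.inv v).Pairwise r) : cs.CommEquiv u v := by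
  induction u generalizing v r with
  | nil =>
    have := hp.length_eq
    simp only [inv_nil, List.length_nil, length_inv] at this
    rw [List.length_eq_zero_iff.1 this.symm]
    exact Relation.ReflTransGen.refl
  | cons a u ih =>
    rw [inv_cons] at hp hu
    obtain ⟨x, b, y, rfl, hb⟩ := R.exists_of_mem_inv (hp.subset List.mem_cons_self)
    rw [inv_append, inv_cons, List.map_cons, hb] at hp hv
    -- A root before α_a in the list of v comes after it in the list of u, where α_a is first. So r
    -- holds in both directions.
    have hx : ∀ γ ∈ R.inv x, ⟪R.simpleRoot a, γ⟫_ℝ = 0 := by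
      intro γ hγ
      have h1 : r γ (R.simpleRoot a) := (List.pairwise_append.1 hv).2.2 γ hγ _ (by simp)
      have h2 := hp.symm.subset (List.mem_append_left _ hγ)
      rcases List.mem_cons.1 h2 with rfl | h2
      · exact hr _ _ h1 h1
      · exact hr _ _ ((List.pairwise_cons.1 hu).1 γ h2) h1
    have hx' := inner_simpleRoot_eq_zero hx
    have hfix := act_wordProd_eq_self hx'
    obtain rfl : b = a := by
      apply R.simpleRoot.injective
      rw [← R.act_inv_act (cs.wordProd x) (R.simpleRoot b), hb, ← hfix, act_inv_act, hfix]
    have hinv : (R.inv (x ++ y)).map (R.act (cs.simple b)) = R.inv x ++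
        ((R.inv y).map (R.act (cs.simple b))).map (R.act (cs.wordProd x)) := by
      rw [inv_append, List.map_append]
      congr 1
      · conv_rhs => rw [← List.map_id (R.inv x)]
        exact List.map_congr_left fun γ hγ => R.act_simple_of_inner_eq_zero (hx γ hγ)
      · simp only [List.map_map]
        congr 1
        funext γ
        simp only [Function.comp_apply, ← act_mul]
        rw [R.simple_mul_eq_mul_simple hb]
    -- Deleting the leading letter b moves the remaining inversions by s_b, so the relation must be
    -- transported as well; this is why the induction generalizes r.
    refine ((ih (v := x ++ y) (r := fun β γ => r (R.act (cs.simple b) β) (R.act (cs.simple b) γ))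
      ?_ ?_ ?_ ?_).cons b).trans (commEquiv_cons_append (fun i hi =>
        commute_of_inner_eq_zero (hx' i hi)) y)
    · intro β γ h1 h2
      rw [← R.inner_act_simple b]
      exact hr _ _ h1 h2
    · have h1 := (hp.trans List.perm_middle).cons_inv
      rw [← hinv] at h1
      have h2 := h1.map (R.act (cs.simple b))
      simpa [Function.comp_def, act_simple_act_simple] using h2
    · exact List.pairwise_map.1 (List.pairwise_cons.1 hu).2
    · rw [← List.pairwise_map, hinv]
      exact hv.sublist (List.sublist_append_iff.2 ⟨_, _, rfl, List.Sublist.refl _,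
        List.sublist_cons_self _ _⟩)

end EuclideanRootSystem
end CoxeterSystem

namespace CoxeterSystem

variable {B W : Type*} [Group W] {M : CoxeterMatrix B}

namespace EuclideanRootSystem

variable {cs : CoxeterSystem M W} {V : Type*} [NormedAddCommGroup V] [InnerProductSpace ℝ V]
  (R : cs.EuclideanRootSystem V)

/-! ### The skew-symmetric form of a Coxeter element -/

/-- The inner product of `α_s` with the component of `x` along the simple roots in `c`. -/
noncomputable def partialInner (c : List B) (s : B) (x : V) : ℝ :=
  (c.map fun j => R.coord j x * ⟪R.simpleRoot s, R.simpleRoot j⟫_ℝ).sum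

/-- The skew-symmetric form `ω_c` of the Coxeter element with word `c`, given by
`ω_c(αᵢ, αⱼ) = -⟪αᵢ, αⱼ⟫` for `i` before `j` in `c`. -/
noncomputable def coxForm : List B → V → V → ℝ
  | [], _, _ => 0
  | s :: c, x, y => coxForm c x y - R.coord s x * R.partialInner c s y
      + R.coord s y * R.partialInner c s x

theorem partialInner_cons (j : B) (c : List B) (s : B) (x : V) :
    R.partialInner (j :: c) s x =
      R.coord j x * ⟪R.simpleRoot s, R.simpleRoot j⟫_ℝ + R.partialInner c s x := by
  simp [partialInner]

theorem partialInner_append (c c' : List B) (s : B) (x : V) :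
    R.partialInner (c ++ c') s x = R.partialInner c s x + R.partialInner c' s x := by
  simp [partialInner]

@[simp] theorem partialInner_nil (s : B) (x : V) : R.partialInner [] s x = 0 := rfl

theorem partialInner_add (c : List B) (s : B) (x y : V) :
    R.partialInner c s (x + y) = R.partialInner c s x + R.partialInner c s y := by
  induction c with
  | nil => simp
  | cons j c ih => simp only [partialInner_cons, ih, map_add]; ring

theorem partialInner_smul (c : List B) (s : B) (a : ℝ) (x : V) :
    R.partialInner c s (a • x) = a * R.partialInner c s x := by
  induction c with
  | nil => simp
  | cons j c ih => simp only [partialInner_cons, ih, map_smul, smul_eq_mul]; ring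

theorem partialInner_congr {c : List B} {s : B} {x y : V}
    (h : ∀ j ∈ c, R.coord j x = R.coord j y) : R.partialInner c s x = R.partialInner c s y := by
  unfold partialInner
  rw [List.map_congr_left fun j hj => by rw [h j hj]]

theorem coxForm_swap (c : List B) (x y : V) : R.coxForm c y x = -R.coxForm c x y := by
  induction c with
  | nil => simp [coxForm]
  | cons s c ih => rw [coxForm, coxForm, ih]; ring

theorem coxForm_add_left (c : List B) (x y z : V) :
    R.coxForm c (x + y) z = R.coxForm c x z + R.coxForm c y z := by
  induction c with
  | nil => simp [coxForm]
  | cons s c ih => simp only [coxForm, ih, map_add, partialInner_add]; ring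

theorem coxForm_smul_left (c : List B) (a : ℝ) (x z : V) :
    R.coxForm c (a • x) z = a * R.coxForm c x z := by
  induction c with
  | nil => simp [coxForm]
  | cons s c ih => simp only [coxForm, ih, map_smul, smul_eq_mul, partialInner_smul]; ring

theorem coxForm_self (c : List B) (x : V) : R.coxForm c x x = 0 := by
  have := R.coxForm_swap c x x
  linarith

theorem coxForm_congr {c : List B} {x x' y y' : V} (hx : ∀ j ∈ c, R.coord j x = R.coord j x')
    (hy : ∀ j ∈ c, R.coord j y = R.coord j y') : R.coxForm c x y = R.coxForm c x' y' := by
  induction c with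
  | nil => rfl
  | cons s c ih =>
    have hx' : ∀ j ∈ c, R.coord j x = R.coord j x' := fun j hj => hx j (by simp [hj])
    have hy' : ∀ j ∈ c, R.coord j y = R.coord j y' := fun j hj => hy j (by simp [hj])
    rw [coxForm, coxForm, ih hx' hy', hx s (by simp), hy s (by simp),
      R.partialInner_congr hx', R.partialInner_congr hy']

theorem coxForm_append_singleton (c : List B) (s : B) (x y : V) :
    R.coxForm (c ++ [s]) x y = R.coxForm c x y + R.coord s x * R.partialInner c s y
      - R.coord s y * R.partialInner c s x := by
  induction c with
  | nil => simp [coxForm]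
  | cons t c ih =>
    rw [List.cons_append, coxForm, coxForm, ih]
    simp only [partialInner_append, partialInner_cons, partialInner_nil,
      real_inner_comm (R.simpleRoot s) (R.simpleRoot t)]
    ring

theorem coxForm_cons_of_coord_eq_zero {c : List B} {s : B} {x y : V} (hx : R.coord s x = 0)
    (hy : R.coord s y = 0) : R.coxForm (s :: c) x y = R.coxForm c x y := by
  rw [coxForm, hx, hy]; ring

theorem coxForm_append_of_coord_eq_zero {c : List B} {s : B} {x y : V} (hx : R.coord s x = 0)
    (hy : R.coord s y = 0) : R.coxForm (c ++ [s]) x y = R.coxForm c x y := by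
  rw [coxForm_append_singleton, hx, hy]; ring

theorem coxForm_simpleRoot_cons {c : List B} {s : B} (hs : s ∉ c) (y : V) :
    R.coxForm (s :: c) (R.simpleRoot s) y = -R.partialInner c s y := by
  have h0 : ∀ j ∈ c, R.coord j (R.simpleRoot s) = R.coord j 0 := fun j hj => by
    rw [coord_simpleRoot_ne R (by rintro rfl; exact hs hj), map_zero]
  have h1 : R.partialInner c s (R.simpleRoot s) = 0 := by
    rw [R.partialInner_congr h0]; simp [partialInner]
  have h2 : R.coxForm c (R.simpleRoot s) y = 0 := by
    rw [R.coxForm_congr h0 fun _ _ => rfl, ← zero_smul ℝ (0 : V), coxForm_smul_left, zero_mul]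
  rw [coxForm, h1, h2, coord_simpleRoot_self]; ring

/-- Moving s from first to last place reverses its order against all other letters, hence the sign
of every pairing with α_s. -/
theorem coxForm_simpleRoot_append {c : List B} {s : B} (hs : s ∉ c) (y : V) :
    R.coxForm (c ++ [s]) (R.simpleRoot s) y = -R.coxForm (s :: c) (R.simpleRoot s) y := by
  have h := R.coxForm_simpleRoot_cons hs y
  rw [coxForm] at h ⊢
  rw [coxForm_append_singleton]
  have h0 : ∀ j ∈ c, R.coord j (R.simpleRoot s) = R.coord j 0 := fun j hj => by
    rw [coord_simpleRoot_ne R (by rintro rfl; exact hs hj), map_zero]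
  have h2 : R.coxForm c (R.simpleRoot s) y = 0 := by
    rw [R.coxForm_congr h0 fun _ _ => rfl, ← zero_smul ℝ (0 : V), coxForm_smul_left, zero_mul]
  rw [h2]; ring

theorem inner_simpleRoot_eq_partialInner {c : List B} (hc : c.Nodup) (s : B) {x : V}
    (hx : ∀ i ∉ c, R.coord i x = 0) : ⟪R.simpleRoot s, x⟫_ℝ = R.partialInner c s x := by
  induction c generalizing x with
  | nil =>
    obtain rfl : x = 0 := R.coord_ext fun i => by rw [hx i (by simp), map_zero]
    simp
  | cons j c ih =>
    rw [List.nodup_cons] at hc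
    have h := ih hc.2 (x := x - R.coord j x • R.simpleRoot j) fun i hi => by
      by_cases hij : i = j
      · subst hij; simp [coord_simpleRoot_self]
      · rw [map_sub, map_smul, coord_simpleRoot_ne R hij, hx i (by simp [hij, hi])]; simp
    rw [inner_sub_right, real_inner_smul_right] at h
    rw [partialInner_cons, R.partialInner_congr (y := x - R.coord j x • R.simpleRoot j), ← h]
    · ring
    · intro i hi
      rw [map_sub, map_smul, coord_simpleRoot_ne R (by rintro rfl; exact hc.1 hi)]; simp

/-- Conjugating a Coxeter element by its initial letter `s` transports the form `ω_c` by `s`. -/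
theorem coxForm_rotate {c : List B} {s : B} (hc : (s :: c).Nodup) {x y : V}
    (hx : ∀ i ∉ s :: c, R.coord i x = 0) (hy : ∀ i ∉ s :: c, R.coord i y = 0) :
    R.coxForm (c ++ [s]) (R.act (cs.simple s) x) (R.act (cs.simple s) y) =
      R.coxForm (s :: c) x y := by
  have hs := (List.nodup_cons.1 hc).1
  have hco : ∀ z : V, ∀ j ∈ c, R.coord j (R.act (cs.simple s) z) = R.coord j z := fun z j hj =>
    coord_act_simple_ne R (by rintro rfl; exact hs hj) z
  have hsz : ∀ z : V, R.coord s (R.act (cs.simple s) z) = R.coord s z -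
      2 * ⟪R.simpleRoot s, z⟫_ℝ / ⟪R.simpleRoot s, R.simpleRoot s⟫_ℝ := fun z => by
    rw [R.act_simple, map_sub, map_smul, coord_simpleRoot_self, smul_eq_mul, mul_one]
  have hb := (R.inner_simpleRoot_self_pos s).ne'
  -- Write P for the partial inner product over c and N for ⟪α_s, α_s⟫. The s-coordinate of s x is
  -- -x_s - 2P(x)/N, and the resulting terms 2P(x)P(y)/N cancel by skew-symmetry.
  rw [coxForm_append_singleton, coxForm, R.coxForm_congr (hco x) (hco y),
    R.partialInner_congr (hco x), R.partialInner_congr (hco y), hsz, hsz,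
    R.inner_simpleRoot_eq_partialInner hc s hx, R.inner_simpleRoot_eq_partialInner hc s hy,
    partialInner_cons, partialInner_cons]
  field_simp
  ring

/-- A letter outside J enters the form only through coordinates that vanish. This links c with its
restriction to W_J. -/
theorem coxForm_restrictTo {J : Set B} (c : List B) {x y : V} (hx : ∀ i ∉ J, R.coord i x = 0)
    (hy : ∀ i ∉ J, R.coord i y = 0) : R.coxForm (c.restrictTo J) x y = R.coxForm c x y := by
  have hpi : ∀ (c : List B) (s : B) {z : V}, (∀ i ∉ J, R.coord i z = 0) →
      R.partialInner (c.restrictTo J) s z = R.partialInner c s z := by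
    intro c s z hz
    induction c with
    | nil => rfl
    | cons j c ih =>
      by_cases hj : j ∈ J
      · rw [restrictTo_cons_of_mem _ hj, partialInner_cons, partialInner_cons, ih]
      · rw [restrictTo_cons_of_notMem _ hj, partialInner_cons, ih, hz j hj]; ring
  induction c with
  | nil => rfl
  | cons j c ih =>
    by_cases hj : j ∈ J
    · rw [restrictTo_cons_of_mem _ hj, coxForm, coxForm, ih, hpi c j hx, hpi c j hy]
    · rw [restrictTo_cons_of_notMem _ hj, coxForm_cons_of_coord_eq_zero R (hx j hj) (hy j hj), ih]

theorem partialInner_nonpos {c : List B} {s : B} (hs : s ∉ c) {x : V} (hx : R.IsPos x) :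
    R.partialInner c s x ≤ 0 := by
  induction c with
  | nil => simp
  | cons j c ih =>
    rw [List.mem_cons, not_or] at hs
    rw [partialInner_cons]
    have := mul_nonpos_of_nonneg_of_nonpos (hx.2 j) (R.inner_simpleRoot_nonpos hs.1)
    linarith [ih hs.2]

theorem coxForm_simpleRoot_nonneg {c : List B} {s : B} (hs : s ∉ c) {x : V} (hx : R.IsPos x) :
    0 ≤ R.coxForm (s :: c) (R.simpleRoot s) x := by
  rw [coxForm_simpleRoot_cons R hs]
  linarith [R.partialInner_nonpos hs hx]

/-- When the form vanishes, only the α_s-component of x contributes to ⟪α_s, x⟫, so s negates the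
s-coordinate. Since s x is still positive, that coordinate is zero. -/
theorem of_coxForm_simpleRoot_eq_zero {c : List B} {s : B} (hc : (s :: c).Nodup) {x : V}
    (hx : R.IsPos x) (hxc : ∀ i ∉ s :: c, R.coord i x = 0) (hxs : x ≠ R.simpleRoot s)
    (h : R.coxForm (s :: c) (R.simpleRoot s) x = 0) :
    R.coord s x = 0 ∧ ⟪R.simpleRoot s, x⟫_ℝ = 0 := by
  rw [coxForm_simpleRoot_cons R (List.nodup_cons.1 hc).1, neg_eq_zero] at h
  have h1 := R.inner_simpleRoot_eq_partialInner hc s hxc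
  rw [partialInner_cons, h, add_zero] at h1
  have h2 := (hx.act_simple hxs).2 s
  have hb := (R.inner_simpleRoot_self_pos s).ne'
  rw [R.act_simple, h1, mul_div_assoc, mul_div_assoc, div_self hb, map_sub, map_smul,
    coord_simpleRoot_self, smul_eq_mul] at h2
  have h3 : R.coord s x = 0 := le_antisymm (by linarith) (hx.2 s)
  exact ⟨h3, by rw [h1, h3, zero_mul]⟩

end EuclideanRootSystem
end CoxeterSystem

namespace CoxeterSystem

variable {B W : Type*} [Group W] {M : CoxeterMatrix B}

namespace EuclideanRootSystem

variable {cs : CoxeterSystem M W} {V : Type*} [NormedAddCommGroup V] [InnerProductSpace ℝ V]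
  (R : cs.EuclideanRootSystem V)

/-! ### Aligned elements -/

/-- The inversions of `w` lie in the span of the simple roots in `c`. -/
def SupportedOn (c : List B) (w : W) : Prop := ∀ x ∈ R.invSet w, ∀ i ∉ c, R.coord i x = 0

/-- `w` is aligned with respect to the Coxeter element with word `c`: if an inversion of `w` is a
positive combination of positive roots `γ` and `δ` with `ω_c(γ, δ) ≥ 0`, then `γ` is an inversion
of `w`. -/
def Aligned (c : List B) (w : W) : Prop :=
  ∀ ⦃x y z : V⦄ ⦃a b : ℝ⦄, R.IsPos y → R.IsPos z → 0 < a → 0 < b → x = a • y + b • z →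
    0 ≤ R.coxForm c y z → x ∈ R.invSet w → y ∈ R.invSet w

/-- The order condition on inversions: `ω_c(x, y) ≥ 0`, with equality only for orthogonal
roots. -/
def OrderRel (c : List B) (x y : V) : Prop :=
  0 ≤ R.coxForm c x y ∧ (R.coxForm c x y = 0 → ⟪x, y⟫_ℝ = 0)

variable {R}

theorem OrderRel.inner_eq_zero {c : List B} {x y : V} (h : R.OrderRel c x y)
    (h' : R.OrderRel c y x) : ⟪x, y⟫_ℝ = 0 := by
  refine h.2 (le_antisymm ?_ h.1)
  have := h'.1
  rw [coxForm_swap] at this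
  linarith

theorem coord_eq_zero_of_combination {x y z : V} {a b : ℝ} (hy : R.IsPos y) (hz : R.IsPos z)
    (ha : 0 < a) (hb : 0 < b) (h : x = a • y + b • z) {i : B} (hi : R.coord i x = 0) :
    R.coord i y = 0 ∧ R.coord i z = 0 := by
  rw [h, map_add, map_smul, map_smul, smul_eq_mul, smul_eq_mul,
    add_eq_zero_iff_of_nonneg (mul_nonneg ha.le (hy.2 i)) (mul_nonneg hb.le (hz.2 i))] at hi
  exact ⟨(mul_eq_zero.1 hi.1).resolve_left ha.ne', (mul_eq_zero.1 hi.2).resolve_left hb.ne'⟩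

theorem SupportedOn.rotate {c : List B} {s : B} {w : W} (h : R.SupportedOn (s :: c) w) :
    R.SupportedOn (c ++ [s]) w := fun x hx i hi => h x hx i (by simpa [or_comm] using hi)

/-- Left multiplication by `s` removes the inversion `α_s`. -/
theorem mem_invSet_of_mem_invSet_simple_mul {s : B} {w : W} (hs : R.simpleRoot s ∈ R.invSet w)
    {x : V} (hx : x ∈ R.invSet (cs.simple s * w)) :
    x ≠ R.simpleRoot s ∧ R.act (cs.simple s) x ∈ R.invSet w := by
  rw [mem_invSet_simple_mul_iff] at hx
  have hne : x ≠ R.simpleRoot s := by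
    rintro rfl
    have := hx.2
    rw [act_simple_simpleRoot, map_neg] at this
    exact hs.2.not_isPos_neg this
  exact ⟨hne, hx.1.act_simple hne, hx.2⟩

theorem SupportedOn.simple_mul {c : List B} {s : B} {w : W} (h : R.SupportedOn (s :: c) w)
    (hs : R.simpleRoot s ∈ R.invSet w) : R.SupportedOn (c ++ [s]) (cs.simple s * w) := by
  intro x hx i hi
  have hi' : i ∉ s :: c := by simpa [or_comm] using hi
  have := h _ (mem_invSet_of_mem_invSet_simple_mul hs hx).2 i hi'
  rwa [coord_act_simple_ne R (by rintro rfl; simp at hi')] at this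

theorem ncard_invSet_simple_mul_lt {s : B} {w : W} (hs : R.simpleRoot s ∈ R.invSet w) :
    (R.invSet (cs.simple s * w)).ncard < (R.invSet w).ncard := by
  have hinj := Function.LeftInverse.injective (R.act_simple_act_simple s)
  rw [← Set.ncard_image_of_injective _ hinj]
  refine Set.ncard_lt_ncard ⟨?_, fun h => ?_⟩ (R.finite_invSet w)
  · rintro _ ⟨x, hx, rfl⟩
    exact (mem_invSet_of_mem_invSet_simple_mul hs hx).2
  · obtain ⟨x, hx, he⟩ := h hs
    have : x = -R.simpleRoot s := by
      rw [← act_simple_simpleRoot, ← he, act_simple_act_simple]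
    exact (R.isPos_simpleRoot s).not_isPos_neg (this ▸ hx.1)

/-- Apply s to the relation x = a y + b z and use the alignment of w. The cases where y or z is α_s,
and so does not stay positive, are treated separately. -/
theorem Aligned.simple_mul {c : List B} {s : B} {w : W} (hc : (s :: c).Nodup)
    (hsupp : R.SupportedOn (s :: c) w) (h : R.Aligned (s :: c) w)
    (hs : R.simpleRoot s ∈ R.invSet w) : R.Aligned (c ++ [s]) (cs.simple s * w) := by
  intro x y z a b hy hz ha hb he hyz hx
  have hsc := (List.nodup_cons.1 hc).1
  have hxs := hsupp.simple_mul hs x hx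
  obtain ⟨hne, hx'⟩ := mem_invSet_of_mem_invSet_simple_mul hs hx
  have hsup : ∀ i ∉ s :: c, R.coord i x = 0 ∧ R.coord i y = 0 ∧ R.coord i z = 0 := fun i hi =>
    have := hxs i (by simpa [or_comm] using hi)
    ⟨this, coord_eq_zero_of_combination hy hz ha hb he this⟩
  by_cases hys : y = R.simpleRoot s
  · exfalso
    subst hys
    rw [coxForm_simpleRoot_append R hsc] at hyz
    -- For y = α_s the two sign conditions force the form to vanish on (α_s, z), hence on (α_s, x).
    -- Then x has s-coordinate zero, although α_s occurs in it with coefficient a > 0.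
    have h0 : R.coxForm (s :: c) (R.simpleRoot s) z = 0 :=
      le_antisymm (by linarith) (R.coxForm_simpleRoot_nonneg hsc hz)
    have h1 : R.coxForm (s :: c) (R.simpleRoot s) x = 0 := by
      rw [coxForm_swap, he, coxForm_add_left, coxForm_smul_left, coxForm_smul_left, coxForm_self,
        coxForm_swap, h0]
      ring
    have h2 := (R.of_coxForm_simpleRoot_eq_zero hc hx.1 (fun i hi => (hsup i hi).1) hne h1).1
    have h3 := (coord_eq_zero_of_combination hy hz ha hb he h2).1
    rw [coord_simpleRoot_self] at h3
    exact one_ne_zero h3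
  rw [mem_invSet_simple_mul_iff]
  refine ⟨hy, ?_⟩
  have hsy := hy.act_simple hys
  by_cases hzs : z = R.simpleRoot s
  · have hroot := R.neg_mem_roots (R.act_mem_roots w⁻¹ hsy.1)
    refine hx'.2.of_eq_combination hs.2 (a := a⁻¹) (b := a⁻¹ * b) (by positivity) (by positivity)
      hroot ?_
    rw [he, hzs, map_add, map_smul, map_smul, act_simple_simpleRoot, map_add, map_smul, map_smul,
      map_neg]
    match_scalars
    · field_simp
    · field_simp
      ring
  · have hsz := hz.act_simple hzs
    refine (h hsy hsz ha hb (x := R.act (cs.simple s) x) ?_ ?_ hx').2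
    · rw [he, map_add, map_smul, map_smul]
    · rw [← R.coxForm_rotate hc, act_simple_act_simple, act_simple_act_simple]
      · exact hyz
      all_goals
        intro i hi
        rw [coord_act_simple_ne R (by rintro rfl; simp at hi)]
      · exact (hsup i hi).2.1
      · exact (hsup i hi).2.2

theorem Aligned.rotate {c : List B} {s : B} {w : W} (h : R.Aligned (s :: c) w)
    (hs : ∀ x ∈ R.invSet w, R.coord s x = 0) : R.Aligned (c ++ [s]) w := by
  intro x y z a b hy hz ha hb he hyz hx
  obtain ⟨h1, h2⟩ := coord_eq_zero_of_combination hy hz ha hb he (hs x hx)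
  refine h hy hz ha hb he ?_ hx
  rwa [coxForm_cons_of_coord_eq_zero R h1 h2, ← coxForm_append_of_coord_eq_zero R h1 h2]

/-- α_s pairs nonnegatively with all positive roots, so it may stand first; the other pairs are
transported by s. -/
theorem pairwise_orderRel_cons {c : List B} {s : B} {ω : List B} (hc : (s :: c).Nodup)
    (hω : R.PosWord (s :: ω)) (hsupp : R.SupportedOn (s :: c) (cs.wordProd (s :: ω)))
    (h : (R.inv ω).Pairwise (R.OrderRel (c ++ [s]))) :
    (R.inv (s :: ω)).Pairwise (R.OrderRel (s :: c)) := by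
  have hsup : ∀ x ∈ R.inv ω, ∀ i ∉ s :: c, R.coord i x = 0 := by
    intro x hx i hi
    rw [← coord_act_simple_ne R (i := i) (j := s) (by rintro rfl; simp at hi)]
    refine hsupp _ (hω.mem_inv_iff.1 ?_) i hi
    rw [inv_cons]
    exact List.mem_cons_of_mem _ (List.mem_map_of_mem hx)
  have hnd := hω.nodup
  rw [inv_cons] at hnd ⊢
  rw [List.pairwise_cons]
  constructor
  · intro y hy
    have hmem : y ∈ R.inv (s :: ω) := by
      rw [inv_cons]; exact List.mem_cons_of_mem _ hy
    have hpos := hω y hmem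
    refine ⟨R.coxForm_simpleRoot_nonneg (List.nodup_cons.1 hc).1 hpos, fun h0 =>
      (R.of_coxForm_simpleRoot_eq_zero hc hpos (hsupp y (hω.mem_inv_iff.1 hmem)) ?_ h0).2⟩
    rintro rfl
    exact (List.nodup_cons.1 hnd).1 hy
  · rw [List.pairwise_map]
    refine h.imp_of_mem fun {x y} hx hy hxy => ?_
    have key : R.coxForm (s :: c) (R.act (cs.simple s) x) (R.act (cs.simple s) y) =
        R.coxForm (c ++ [s]) x y := by
      rw [← R.coxForm_rotate hc, act_simple_act_simple, act_simple_act_simple]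
      all_goals
        intro i hi
        rw [coord_act_simple_ne R (by rintro rfl; simp at hi)]
      · exact hsup x hx i hi
      · exact hsup y hy i hi
    unfold OrderRel
    rw [key, R.inner_act_simple]
    exact hxy

theorem OrderRel.of_coord_eq_zero {c : List B} {s : B} {x y : V} (hx : R.coord s x = 0)
    (hy : R.coord s y = 0) (h : R.OrderRel (c ++ [s]) x y) : R.OrderRel (s :: c) x y := by
  unfold OrderRel at *
  rwa [coxForm_cons_of_coord_eq_zero R hx hy, ← coxForm_append_of_coord_eq_zero R hx hy]

/-! ### Left descents and supports of aligned elements -/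

/-- `ω_c(v α_s, y) ≥ 0` if `ω_c(α_s, y) ≥ 0` and `ω_c(x, y) ≥ 0` for the inversions `x` of `v`. -/
theorem coxForm_act_wordProd_nonneg {c : List B} {s : B} {ω : List B} (hs : s ∉ ω) {y : V}
    (hsy : 0 ≤ R.coxForm c (R.simpleRoot s) y) (h : ∀ x ∈ R.inv ω, 0 ≤ R.coxForm c x y) :
    0 ≤ R.coxForm c (R.act (cs.wordProd ω) (R.simpleRoot s)) y := by
  induction ω using List.reverseRecOn with
  | nil => simpa
  | append_singleton ω a ih =>
    rw [inv_append_singleton] at h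
    have has : a ≠ s := by rintro rfl; simp at hs
    rw [cs.wordProd_append, cs.wordProd_singleton, act_mul, R.act_simple, map_sub, map_smul,
      sub_eq_add_neg, ← neg_smul, coxForm_add_left, coxForm_smul_left]
    refine add_nonneg (ih (by simp at hs; exact hs.1) fun x hx => h x (by simp [hx]))
      (mul_nonneg ?_ (h _ (by simp)))
    rw [neg_nonneg]
    exact div_nonpos_of_nonpos_of_nonneg (by linarith [R.inner_simpleRoot_nonpos has])
      (R.inner_simpleRoot_self_pos a).le

/-- Strip the last letter a of v = v' s_a. Then v(α_s) = v'(α_s) + k v'(α_a) with k ≥ 0, and the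
form is nonnegative on (v'(α_s), v'(α_a)), so alignment passes the inversion from v(α_s) to v'(α_s),
and finally to α_s. -/
theorem Aligned.simpleRoot_mem_invSet {c : List B} {s : B} {w : W} (hs : s ∉ c)
    (h : R.Aligned (s :: c) w) {ω : List B} (hωc : ∀ i ∈ ω, i ∈ c) (hω : R.PosWord ω)
    (hpw : (R.inv ω).Pairwise (R.OrderRel c))
    (hmem : R.act (cs.wordProd ω) (R.simpleRoot s) ∈ R.invSet w) :
    R.simpleRoot s ∈ R.invSet w := by
  induction ω using List.reverseRecOn with
  | nil => simpa using hmem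
  | append_singleton ω a ih =>
    have hωc' : ∀ i ∈ ω, i ∈ c := fun i hi => hωc i (by simp [hi])
    have hsω : s ∉ ω := fun h' => hs (hωc' s h')
    have has : a ≠ s := by rintro rfl; exact hs (hωc a (by simp))
    have hsup : ∀ x ∈ R.inv (ω ++ [a]), R.coord s x = 0 := fun x hx =>
      (mem_parabolicRoots_iff.1 (mem_parabolicRoots_of_mem_inv (J := {i | i ∈ c}) hωc hx)).2 s hs
    unfold PosWord at hω ih
    rw [inv_append_singleton] at hω hpw hsup
    refine ih hωc' (fun x hx => hω x (by simp [hx])) (List.pairwise_append.1 hpw).1 ?_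
    set y := R.act (cs.wordProd ω) (R.simpleRoot a) with hy
    have hypos : R.IsPos y := hω y (by simp)
    have heq : R.act (cs.wordProd (ω ++ [a])) (R.simpleRoot s) =
        R.act (cs.wordProd ω) (R.simpleRoot s) +
        (-(2 * ⟪R.simpleRoot a, R.simpleRoot s⟫_ℝ / ⟪R.simpleRoot a, R.simpleRoot a⟫_ℝ)) • y := by
      rw [cs.wordProd_append, cs.wordProd_singleton, act_mul, R.act_simple, map_sub, map_smul,
        sub_eq_add_neg, ← neg_smul]
    rw [heq] at hmem
    rcases (R.inner_simpleRoot_nonpos has).eq_or_lt with h0 | h0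
    · rw [h0] at hmem
      simpa using hmem
    · refine h (R.isPos_act_wordProd_simpleRoot hsω) hypos one_pos ?_ (by rw [one_smul]) ?_ hmem
      · rw [neg_pos]
        exact div_neg_of_neg_of_pos (by linarith) (R.inner_simpleRoot_self_pos a)
      · refine coxForm_act_wordProd_nonneg hsω (R.coxForm_simpleRoot_nonneg hs hypos) ?_
        intro x hx
        rw [coxForm_cons_of_coord_eq_zero R (hsup x (by simp [hx])) (hsup y (by simp))]
        exact ((List.pairwise_append.1 hpw).2.2 x hx y (by simp)).1

theorem mem_of_supportedOn {c ω : List B} (hω : R.PosWord ω)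
    (h : R.SupportedOn c (cs.wordProd ω)) : ∀ i ∈ ω, i ∈ c :=
  mem_of_inv_subset_parabolicRoots (R := R) (J := {i | i ∈ c}) fun x hx =>
    mem_parabolicRoots_iff.2 ⟨(hω x hx).1, h x (hω.mem_inv_iff.1 hx)⟩

/-- Let u be the component of w in the parabolic subgroup of the letters of c. If w ≠ u, some u(α_b)
is an inversion of w; necessarily b = s, and `Aligned.simpleRoot_mem_invSet` brings this down to
α_s. The hypothesis `hex` is the induction hypothesis of `Aligned.exists_pairwise_orderRel` for the
shorter word. -/
theorem SupportedOn.of_simpleRoot_notMem_aux {c : List B} {s : B} {w : W} (hs : s ∉ c)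
    (hsupp : R.SupportedOn (s :: c) w) (h : R.Aligned (s :: c) w)
    (hsw : R.simpleRoot s ∉ R.invSet w)
    (hex : ∀ u : W, R.SupportedOn c u → R.Aligned c u → ∃ ω, R.PosWord ω ∧ cs.wordProd ω = u ∧
      (R.inv ω).Pairwise (R.OrderRel c)) : R.SupportedOn c w := by
  obtain ⟨ω, hω, rfl⟩ := R.exists_posWord w
  set w := cs.wordProd ω with hw
  obtain ⟨υ, hυc, hυ⟩ := exists_restrictTo_inv_eq (R := R) {i | i ∈ c} ω
  have hmemυ : ∀ x, x ∈ R.inv υ ↔ x ∈ R.invSet w ∧ x ∈ R.parabolicRoots {i | i ∈ c} := by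
    intro x
    rw [← hυ, mem_restrictTo, hω.mem_inv_iff]
  have hυpos : R.PosWord υ := fun x hx => ((hmemυ x).1 hx).1.1
  set u := cs.wordProd υ with hu
  have hmem : ∀ x, x ∈ R.invSet u ↔ x ∈ R.invSet w ∧ x ∈ R.parabolicRoots {i | i ∈ c} := by
    intro x
    rw [← hυpos.mem_inv_iff, hmemυ]
  have husupp : R.SupportedOn c u := fun x hx i hi =>
    (mem_parabolicRoots_iff.1 ((hmem x).1 hx).2).2 i hi
  have hual : R.Aligned c u := by
    intro x y z a b hy hz ha hb he hyz hx
    have hyz0 : ∀ i ∉ c, R.coord i y = 0 ∧ R.coord i z = 0 := fun i hi =>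
      coord_eq_zero_of_combination hy hz ha hb he (husupp x hx i hi)
    rw [hmem]
    refine ⟨h hy hz ha hb he ?_ ((hmem x).1 hx).1,
      mem_parabolicRoots_iff.2 ⟨hy.1, fun i hi => (hyz0 i hi).1⟩⟩
    rwa [coxForm_cons_of_coord_eq_zero R (hyz0 s hs).1 (hyz0 s hs).2]
  obtain ⟨ξ, hξ, hξu, hpw⟩ := hex u husupp hual
  obtain ⟨τ, hτ, hτu⟩ := R.exists_posWord (u⁻¹ * w)
  cases τ with
  | nil =>
    rw [cs.wordProd_nil, eq_comm, inv_mul_eq_one] at hτu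
    rwa [← hτu]
  | cons b τ =>
    exfalso
    have hb : R.simpleRoot b ∈ R.invSet (u⁻¹ * w) := by
      rw [← hτu, ← hτ.mem_inv_iff, inv_cons]
      exact List.mem_cons_self
    have hb' := hb.2
    rw [mul_inv_rev, inv_inv, act_mul] at hb'
    -- For b ∈ c the root u(α_b) lies in the subsystem of c, where u and w have the same inversions.
    -- Either sign of it contradicts this.
    have hbc : b ∉ c := by
      intro hbc
      have hJ : R.act u (R.simpleRoot b) ∈ R.parabolicRoots {i | i ∈ c} := by
        rw [hu, act_wordProd_mem_parabolicRoots_iff hυc, simpleRoot_mem_parabolicRoots_iff]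
        exact hbc
      rcases R.isPos_or_isPos_neg hJ.1 with h1 | h1
      · have h3 := ((hmem _).2 ⟨⟨h1, hb'⟩, hJ⟩).2
        rw [act_inv_act] at h3
        exact (R.isPos_simpleRoot b).not_isPos_neg h3
      · have h2 : -R.act u (R.simpleRoot b) ∈ R.invSet u :=
          ⟨h1, by simpa [act_inv_act] using R.isPos_simpleRoot b⟩
        have h3 := ((hmem _).1 h2).1.2
        rw [map_neg, neg_neg] at h3
        exact h3.not_isPos_neg hb'
    have hbυ : b ∉ υ := fun h' => hbc (hυc b h')
    have hub : R.act u (R.simpleRoot b) ∈ R.invSet w :=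
      ⟨R.isPos_act_wordProd_simpleRoot hbυ, hb'⟩
    have hbs : b = s := by
      by_contra hbs
      have := hsupp _ hub b (by simp [hbs, hbc])
      rw [hu, coord_act_wordProd R hbυ, coord_simpleRoot_self] at this
      exact one_ne_zero this
    subst hbs
    refine hsw (h.simpleRoot_mem_invSet hs (ω := ξ) ?_ hξ hpw (by rw [hξu]; exact hub))
    exact mem_of_supportedOn hξ (by rw [hξu]; exact husupp)

/-- A double induction: rotating c keeps its length but lowers the number of inversions when s is a
left descent; otherwise s is dropped from c. -/
theorem Aligned.exists_pairwise_orderRel {c : List B} (hc : c.Nodup) {w : W}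
    (hsupp : R.SupportedOn c w) (h : R.Aligned c w) :
    ∃ ω, R.PosWord ω ∧ cs.wordProd ω = w ∧ (R.inv ω).Pairwise (R.OrderRel c) := by
  induction hn : c.length generalizing c w with
  | zero =>
    rw [List.length_eq_zero_iff] at hn
    subst hn
    refine ⟨[], posWord_nil, ?_, by simp⟩
    rw [cs.wordProd_nil, eq_comm]
    refine eq_one_of_invSet_eq_empty (R := R) (Set.eq_empty_iff_forall_notMem.2 fun x hx => ?_)
    exact hx.1.ne_zero (R.coord_ext fun i => by rw [hsupp x hx i (by simp), map_zero])
  | succ n ihn =>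
    induction hm : (R.invSet w).ncard using Nat.strong_induction_on generalizing c w with
    | _ m ihm =>
      obtain _ | ⟨s, c⟩ := c
      · simp at hn
      have hlen : c.length = n := by simpa using hn
      by_cases hs : R.simpleRoot s ∈ R.invSet w
      · obtain ⟨ω, hω, hωw, hpw⟩ := ihm _ (hm ▸ ncard_invSet_simple_mul_lt hs) (c := c ++ [s])
          (List.nodup_append_comm.1 hc) (hsupp.simple_mul hs) (h.simple_mul hc hsupp hs)
          (by simp [hlen]) rfl
        have hw : cs.wordProd (s :: ω) = w := by
          rw [cs.wordProd_cons, hωw, cs.simple_mul_simple_cancel_left]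
        have hω' : R.PosWord (s :: ω) := hω.cons fun h' =>
          (mem_invSet_of_mem_invSet_simple_mul hs (hωw ▸ h')).1 rfl
        exact ⟨s :: ω, hω', hw, pairwise_orderRel_cons hc hω' (hw ▸ hsupp) hpw⟩
      · rw [List.nodup_cons] at hc
        have hex := fun u hu hu' => ihn (c := c) hc.2 (w := u) hu hu' hlen
        have hsupp' := hsupp.of_simpleRoot_notMem_aux hc.1 h hs hex
        have hal : R.Aligned c w := by
          intro x y z a b hy hz ha hb he hyz hx
          obtain ⟨h1, h2⟩ := coord_eq_zero_of_combination hy hz ha hb he (hsupp' x hx s hc.1)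
          exact h hy hz ha hb he (by rwa [coxForm_cons_of_coord_eq_zero R h1 h2]) hx
        obtain ⟨ω, hω, hωw, hpw⟩ := hex w hsupp' hal
        refine ⟨ω, hω, hωw, hpw.imp_of_mem fun {x y} hx hy hxy => ?_⟩
        have h0 : ∀ x ∈ R.inv ω, R.coord s x = 0 := fun x hx =>
          hsupp' x (hωw ▸ hω.mem_inv_iff.1 hx) s hc.1
        unfold OrderRel at *
        rwa [coxForm_cons_of_coord_eq_zero R (h0 x hx) (h0 y hy)]

/-- If the initial letter `s` of `c` is not a left descent of an aligned element `w`, then `w` lies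
in the standard parabolic subgroup of the other letters. -/
theorem SupportedOn.of_simpleRoot_notMem {c : List B} {s : B} {w : W} (hc : (s :: c).Nodup)
    (hsupp : R.SupportedOn (s :: c) w) (h : R.Aligned (s :: c) w)
    (hsw : R.simpleRoot s ∉ R.invSet w) : R.SupportedOn c w :=
  hsupp.of_simpleRoot_notMem_aux (List.nodup_cons.1 hc).1 h hsw
    fun _ hu hu' => hu'.exists_pairwise_orderRel (List.nodup_cons.1 hc).2 hu

end EuclideanRootSystem
end CoxeterSystem

namespace CoxeterSystem

variable {B W : Type*} [Group W] {M : CoxeterMatrix B}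

/-! ### Positions of subwords -/

theorem getElem?_rotate_mod (s : B) (c : List B) (k : ℕ) :
    (c ++ [s])[k % (c ++ [s]).length]? = (s :: c)[(k + 1) % (s :: c).length]? := by
  have h : c ++ [s] = (s :: c).rotate 1 := by simp
  have hlt : k % (s :: c).length < (s :: c).length := Nat.mod_lt _ (by simp)
  rw [h, List.length_rotate, List.getElem?_rotate hlt, Nat.mod_add_mod]

theorem isSubwordAt_map_succ_iff {s : B} {c : List B} {p : List ℕ} {ω : List B} :
    IsSubwordAt (s :: c) (p.map (· + 1)) ω ↔ IsSubwordAt (c ++ [s]) p ω := by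
  unfold IsSubwordAt
  rw [List.pairwise_map, List.map_map]
  simp only [Nat.add_lt_add_iff_right]
  refine and_congr_right fun _ => ?_
  rw [List.map_congr_left fun k _ => getElem?_rotate_mod s c k]
  rfl

theorem isSubwordAt_zero_cons_iff {s : B} {c : List B} {p : List ℕ} {ω : List B} :
    IsSubwordAt (s :: c) (0 :: p.map (· + 1)) (s :: ω) ↔ IsSubwordAt (c ++ [s]) p ω := by
  rw [← isSubwordAt_map_succ_iff]
  simp [IsSubwordAt]

theorem exists_eq_map_succ {p : List ℕ} (h : ∀ k ∈ p, 0 < k) : ∃ q : List ℕ, p = q.map (· + 1) := by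
  refine ⟨p.map (· - 1), ?_⟩
  rw [List.map_map]
  conv_lhs => rw [← List.map_id p]
  refine List.map_congr_left fun k hk => ?_
  have := h k hk
  simp
  omega

theorem lex_map_succ_iff {p q : List ℕ} :
    List.Lex (· < ·) (p.map (· + 1)) (q.map (· + 1)) ↔ List.Lex (· < ·) p q := by
  induction p generalizing q with
  | nil => cases q <;> simp
  | cons a p ih => cases q with
    | nil => simp
    | cons b q => simp [List.cons_lex_cons_iff, ih]

theorem map_succ_injective : Function.Injective (List.map (· + 1) : List ℕ → List ℕ) :=
  List.map_injective_iff.2 fun _ _ h => Nat.succ_injective h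

/-! ### Inversion order of sorting words -/

namespace EuclideanRootSystem

variable {cs : CoxeterSystem M W} {V : Type*} [NormedAddCommGroup V] [InnerProductSpace ℝ V]
  {R : cs.EuclideanRootSystem V}

/-- The inversions of the sorting word of an aligned element satisfy the order condition. -/
theorem Aligned.pairwise_orderRel_of_first {J : Set B} {c : List B} (hc : IsCoxeterWord J c)
    {w : W} (hsupp : R.SupportedOn c w) (h : R.Aligned c w) {ω : List B}
    (hω : cs.IsReducedExpr J w ω) {p : List ℕ} (hp : IsSubwordAt c p ω)
    (hfirst : ∀ q ω', IsSubwordAt c q ω' → cs.IsReducedExpr J w ω' →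
      p = q ∨ List.Lex (· < ·) p q) : (R.inv ω).Pairwise (R.OrderRel c) := by
  -- The summand 1 per position makes the measure drop even when position 0 is removed and nothing
  -- is left to shift.
  induction hn : (p.map (· + 1)).sum using Nat.strong_induction_on
    generalizing c w ω p with
  | _ n ih =>
    have hpos : R.PosWord ω := hω.posWord
    obtain rfl := hω.2.1
    obtain _ | ⟨a, ω⟩ := ω
    · simp
    obtain _ | ⟨s, c⟩ := c
    · exact absurd ((hc.2 a).2 (hω.1 a (by simp))) (by simp)
    have hrot : IsCoxeterWord J (c ++ [s]) :=
      ⟨List.nodup_append_comm.1 hc.1, fun i => by rw [← hc.2 i]; simp [or_comm]⟩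
    obtain _ | ⟨k, p⟩ := p
    · simp [IsSubwordAt] at hp
    have hgt : ∀ m ∈ p, k < m := (List.pairwise_cons.1 hp.1).1
    obtain ⟨q, rfl⟩ := exists_eq_map_succ fun m hm => (Nat.zero_le k).trans_lt (hgt m hm)
    obtain _ | k := k
    · obtain rfl : s = a := by
        have := hp.2
        simp at this
        exact this.1
      have hs : R.simpleRoot s ∈ R.invSet (cs.wordProd (s :: ω)) := by
        rw [← hpos.mem_inv_iff, inv_cons]
        exact List.mem_cons_self
      have hmul : cs.simple s * cs.wordProd (s :: ω) = cs.wordProd ω := by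
        rw [cs.wordProd_cons, cs.simple_mul_simple_cancel_left]
      refine pairwise_orderRel_cons hc.1 hpos hsupp
        (ih _ ?_ hrot (hmul ▸ hsupp.simple_mul hs) (hmul ▸ h.simple_mul hc.1 hsupp hs) hω.tail
          (isSubwordAt_zero_cons_iff.1 hp) ?_ rfl)
      · rw [← hn, List.map_cons, List.sum_cons, List.map_map]
        have : (q.map (· + 1)).sum ≤ (q.map ((· + 1) ∘ (· + 1))).sum :=
          List.sum_le_sum fun i _ => by simp
        omega
      · intro q' ω' hq' hω'
        have hω'pos : R.PosWord (s :: ω') := by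
          refine (hω'.posWord (R := R)).cons fun h' => ?_
          rw [hω'.2.1] at h'
          exact (mem_invSet_of_mem_invSet_simple_mul hs (hmul ▸ h')).1 rfl
        have hred := hω'pos.isReducedExpr (J := J)
          (by simpa using ⟨hω.1 s (by simp), hω'.1⟩)
        rw [cs.wordProd_cons, hω'.2.1, ← cs.wordProd_cons] at hred
        rcases hfirst _ _ (isSubwordAt_zero_cons_iff.2 hq') hred with h1 | h1
        · exact Or.inl (map_succ_injective (List.cons_injective h1))
        · rw [List.cons_lex_cons_iff, lex_map_succ_iff] at h1
          exact Or.inr (by simpa using h1)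
    -- Were s a left descent, a reduced expression beginning with s could start at position 0 and
    -- would be lexicographically earlier.
    · have hs : R.simpleRoot s ∉ R.invSet (cs.wordProd (a :: ω)) := by
        intro hs
        have hsJ : s ∈ J := (hc.2 s).1 (by simp)
        obtain ⟨ω', hω'⟩ := cs.exists_isReducedExpr (J := J)
          (w := cs.simple s * cs.wordProd (a :: ω))
          (mul_mem (Subgroup.subset_closure ⟨s, hsJ, rfl⟩) (wordProd_mem_parabolic hω.1))
        obtain ⟨q', hq'⟩ := exists_isSubwordAt hrot ω' hω'.1
        have hω'pos : R.PosWord (s :: ω') := by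
          refine (hω'.posWord (R := R)).cons fun h' => ?_
          rw [hω'.2.1] at h'
          exact (mem_invSet_of_mem_invSet_simple_mul hs h').1 rfl
        have hred := hω'pos.isReducedExpr (J := J) (by simpa using ⟨hsJ, hω'.1⟩)
        rw [cs.wordProd_cons, hω'.2.1, cs.simple_mul_simple_cancel_left] at hred
        rcases hfirst _ _ (isSubwordAt_zero_cons_iff.2 hq') hred with h1 | h1
        · simp at h1
        · rw [List.cons_lex_cons_iff] at h1
          simp at h1
      have hsupp' := hsupp.of_simpleRoot_notMem hc.1 h hs
      have hsc := (List.nodup_cons.1 hc.1).1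
      have hcoord : ∀ x ∈ R.inv (a :: ω), R.coord s x = 0 := fun x hx =>
        hsupp' x (hpos.mem_inv_iff.1 hx) s hsc
      have hp' : IsSubwordAt (c ++ [s]) (k :: q) (a :: ω) := by
        rw [← isSubwordAt_map_succ_iff]
        exact hp
      refine (ih _ ?_ hrot hsupp.rotate (h.rotate fun x hx => hsupp' x hx s hsc) hω hp' ?_
        rfl).imp_of_mem fun {x y} hx hy hxy => hxy.of_coord_eq_zero (hcoord x hx) (hcoord y hy)
      · rw [← hn, List.map_cons, List.sum_cons, List.map_cons, List.sum_cons, List.map_map]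
        have : (q.map (· + 1)).sum ≤ (q.map ((· + 1) ∘ (· + 1))).sum :=
          List.sum_le_sum fun i _ => by simp
        omega
      · intro q' ω' hq' hω'
        have := hfirst _ _ (isSubwordAt_map_succ_iff.2 hq') hω'
        rwa [← List.map_cons (f := (· + 1)), lex_map_succ_iff, map_succ_injective.eq_iff] at this

theorem pairwise_orderRel_sortingWord {J : Set B} {c : List B} (hc : IsCoxeterWord J c)
    {w : W} (hw : cs.IsLongest J w) :
    (R.inv (cs.sortingWord J c w)).Pairwise (R.OrderRel c) := by
  obtain ⟨hω, p, hp, hfirst⟩ := cs.isSortingWord_sortingWord hc hw.1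
  have hsupp : R.SupportedOn c w := by
    intro x hx i hi
    rw [hw.invSet_eq] at hx
    exact (mem_parabolicRoots_iff.1 hx.2).2 i fun hiJ => hi ((hc.2 i).2 hiJ)
  refine Aligned.pairwise_orderRel_of_first hc hsupp ?_ hω hp hfirst
  -- Alignment of a longest element needs no sign condition: y lies in the subsystem because x does,
  -- and all its positive roots are inverted.
  intro x y z a b hy hz ha hb he _ hx
  rw [hw.invSet_eq]
  refine ⟨hy, mem_parabolicRoots_iff.2 ⟨hy.1, fun i hi => ?_⟩⟩
  exact (coord_eq_zero_of_combination hy hz ha hb he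
    (hsupp x hx i fun hic => hi ((hc.2 i).1 hic))).1

end EuclideanRootSystem
end CoxeterSystem

open CoxeterSystem EuclideanRootSystem in
theorem mainTheorem8 {B W V : Type*} [Group W] [Finite W] {M : CoxeterMatrix B}
    (cs : CoxeterSystem M W) [NormedAddCommGroup V] [InnerProductSpace ℝ V]
    (R : cs.EuclideanRootSystem V)
    (c : List B) (hc : CoxeterSystem.IsCoxeterWord Set.univ c) (J : Set B)
    (w₀ : W) (hw₀ : cs.IsLongest Set.univ w₀)
    (w₀' : W) (hw₀' : cs.IsLongest J w₀') :
    ∃ u : List B, (∀ i ∈ u, i ∈ J) ∧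
      cs.CommEquiv u (cs.sortingWord J (c.restrictTo J) w₀') ∧
      (R.inv (cs.sortingWord Set.univ c w₀)).restrictTo (R.parabolicRoots J) = R.inv u := by
  have hc' : IsCoxeterWord J (c.restrictTo J) :=
    ⟨hc.1.sublist (restrictTo_sublist c J), fun i => by simp [mem_restrictTo, hc.2 i]⟩
  obtain ⟨u, huJ, hu⟩ := exists_restrictTo_inv_eq (R := R) J (cs.sortingWord Set.univ c w₀)
  refine ⟨u, huJ, ?_, hu⟩
  have hred := (cs.isSortingWord_sortingWord hc hw₀.1).1
  have hred' := (cs.isSortingWord_sortingWord hc' hw₀'.1).1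
  have hpos : R.PosWord (cs.sortingWord Set.univ c w₀) := hred.posWord
  have hpos' : R.PosWord (cs.sortingWord J (c.restrictTo J) w₀') := hred'.posWord
  have hmem : ∀ x, x ∈ R.inv u ↔ R.IsPos x ∧ x ∈ R.parabolicRoots J := by
    intro x
    rw [← hu, mem_restrictTo, hpos.mem_inv_iff, hred.2.1, hw₀.invSet_eq]
    simp only [Set.mem_ofPred_eq, and_congr_left_iff, and_iff_left_iff_imp]
    exact fun h _ => mem_parabolicRoots_iff.2 ⟨h.1, by simp⟩
  have hposu : R.PosWord u := fun x hx => ((hmem x).1 hx).1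
  refine commEquiv_of_pairwise (r := R.OrderRel (c.restrictTo J))
    (fun x y h h' => h.inner_eq_zero h') ?_ ?_ (pairwise_orderRel_sortingWord hc' hw₀')
  · rw [List.perm_ext_iff_of_nodup hposu.nodup hpos'.nodup]
    intro x
    rw [hmem, hpos'.mem_inv_iff, hred'.2.1, hw₀'.invSet_eq]
    rfl
  -- The order condition for c passes to the sublist and, on roots of the subsystem, is the one for
  -- the restricted word.
  · have hpw := (pairwise_orderRel_sortingWord (R := R) hc hw₀).sublist
      (restrictTo_sublist _ (R.parabolicRoots J))
    rw [hu] at hpw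
    refine hpw.imp_of_mem fun {x y} hx hy hxy => ?_
    unfold OrderRel at *
    rwa [coxForm_restrictTo R c (mem_parabolicRoots_iff.1 ((hmem x).1 hx).2).2
      (mem_parabolicRoots_iff.1 ((hmem y).1 hy).2).2]
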